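/- Let $n\ge 2$ be an integer. Consider the recursive algorithm $M_n$ on real inputs given by $$M_n(x)=\begin{cases}-x,&\text{if }x<0,\\ \underbrace{M_n(x-M_n(x-M_n(\cdots M_n(x-1)\cdots)))}_{n\text{ instances of }M_n}/n,&\text{otherwise.}\end{cases}$$ In other words, on input $x\ge 0$ the algorithm puts $t_0=1$, computes $t_i=M_n(x-t_{i-1})$ for $i=1,\dots,n$, and returns $t_n/n$. Let $g_n(x_1,\dots,x_n)=(x_1+\cdots+x_n+1)/n$, and let the set $\mathcal F_n\subset\mathbb R$ of $n$-fusible numbers be the inclusion-least set of reals such that $0\in\mathcal F_n$, and $g_n(x_1,\dots,x_n)\in\mathcal F_n$ whenever $x_1,\dots,x_n\in\mathcal F_n$ and $g_n(x_1,\dots,x_n)>\max\{x_1,\dots,x_n\}$. Let $\varphi_0(\alpha)=\omega^\alpha$, and for each $m\in\mathbb N$ let $\varphi_{m+1}$ be the function that enumerates the fixed points of $\varphi_m$ in increasing order (the finite levels of the Veblen hierarchy). Then: 1. $M_n$ terminates on every real input, so that it defines a function $M_n\colon\mathbb R\to\mathbb R$. 2. The set $\mathcal F'_n=\{x+M_n(x)\mid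 x\in\mathbb R\}$ is a subset of $\mathcal F_n$. 3. $\mathcal F'_n$ is well ordered by $<$, with order type $\varphi_{n-1}(0)$. 4. $\mathcal F_n$ is well ordered by $<$, with order type exactly $\varphi_{n-1}(0)$. -/

import Mathlib

/-- The function `g_n(x_1, …, x_n) = (x_1 + ⋯ + x_n + 1) / n`. -/
noncomputable def fuseFun (n : ℕ) (x : Fin n → ℝ) : ℝ :=
  (∑ i, x i + 1) / n

/-- Membership in `ℱ({g}, P)`: the least set of reals that contains `P` and contains
`g(x_1, …, x_n)` whenever it contains `x_1, …, x_n` and `g(x_1, …, x_n)` exceeds all of them. -/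
inductive Generated {n : ℕ} (g : (Fin n → ℝ) → ℝ) (P : Set ℝ) : ℝ → Prop
  | base (x : ℝ) (hx : x ∈ P) : Generated g P x
  | app (x : Fin n → ℝ) (hx : ∀ i, Generated g P (x i)) (hlt : ∀ i, x i < g x) :
      Generated g P (g x)

/-- The set `ℱ_n = ℱ({g_n}, {0})` of `n`-fusible numbers. -/
def fusible (n : ℕ) : Set ℝ := {z | Generated (fuseFun n) {0} z}

/-- Big-step semantics of the recursive algorithm `M_n`: `MRuns n x y` says that the call `M_n(x)`
terminates (after finitely many recursive calls, each call making `n` calls of its own when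
`x ≥ 0`) and returns `y`.  For `x < 0` it returns `-x`.  For `x ≥ 0` it puts `t_0 = 1`, calls in
turn `t_{i+1} = M_n(x - t_i)` for `i = 0, …, n - 1`, and returns `t_n / n`; that is, it returns
`M_n(x - M_n(x - M_n(⋯ M_n(x - 1) ⋯))) / n` with `n` nested instances of `M_n`. -/
inductive MRuns (n : ℕ) : ℝ → ℝ → Prop
  | neg (x : ℝ) (hx : x < 0) : MRuns n x (-x)
  | nonneg (x : ℝ) (hx : 0 ≤ x) (t : ℕ → ℝ) (h_zero : t 0 = 1)
      (h_call : ∀ i, i < n → MRuns n (x - t i) (t (i + 1))) : MRuns n x (t n / n)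

/-- The set `ℱ'_n = {x + M_n(x) : x ∈ ℝ}` (over those `x` on which `M_n` terminates). -/
def fusible' (n : ℕ) : Set ℝ := {z | ∃ x y : ℝ, MRuns n x y ∧ z = x + y}

/-- The set `S` of reals is well ordered by `<`, with order type `o`. -/
def HasOrderType (S : Set ℝ) (o : Ordinal.{0}) : Prop :=
  ∃ h : IsWellOrder S (· < ·), @Ordinal.type S (· < ·) h = o

/-! Upper bound. A nonzero element z of `fusible n` splits: there are n smaller elements whose
distances to z add up to 1. This alone forces well-ordering (`IsFusionSet.isWF`), and splittings
survive in the closure, where entries may equal z. Each z has finitely many splittings, and points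
slightly to its left split only in ways dominated by those of z. Hence the left rank of z, a
one-sided Cantor–Bendixson rank, is controlled by the number of entries equal to z and by the ranks
of the other entries. With no equal entry it is at most the combined rank of the entries; each
further equal entry costs one Veblen level (`leftRank_le_veblenOpow`). At most n - 1 entries equal
z, and if n - 1 do, the last one is z - 1. So the ranks up to N + 1 are bounded through those up to
N and stay below φ_{n-1}(0), and so do the order types of initial segments (`initRank_le_add_opow`).

Lower bound. The function x + M_n(x) is constant on gaps, and the intermediate value t_i is affine
of slope -i on pieces. On a level-i piece starting at p, the map x ↦ x - t_i(x) is affine of slope i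
+ 1, so the level-(i+1) pieces inside it are a scaled copy of the gaps from p - t_i(p) on. This copy
feeds on itself, because it also copies gaps inside the piece. By downward induction on i, the end
of a level-i piece carries tails one index further along φ_{n-1-i} than its start
(`hasTails_veblen`). Level 0 is the single piece starting at 0 and yields φ_{n-1}(0).

Termination follows from the same well-ordering, and the order type of any set between `fusible' n`
and `fusible n` is squeezed between the two bounds. -/

/-! ### Combining ordinals strictly monotonically -/

/-- An operation on ordinals that is strictly increasing in each of its arguments. -/
noncomputable def mixOp (a b : Ordinal.{0}) : Ordinal.{0} :=
  (max a b + 1) * max a b + min a b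

theorem mixOp_comm (a b : Ordinal.{0}) : mixOp a b = mixOp b a := by
  rw [mixOp, mixOp, max_comm, min_comm]

/-- With M the maximum and m ≤ M the minimum, (M + 1) * M + m orders pairs first by M and then by m;
raising one argument raises M, or keeps M and raises m. -/
theorem mixOp_strictMono_left (b : Ordinal.{0}) : StrictMono fun a => mixOp a b := by
  intro a a' h
  change mixOp a b < mixOp a' b
  rcases le_or_gt a' b with hb | hb
  · have h1 : max a b = b := max_eq_right (h.le.trans hb)
    have h2 : max a' b = b := max_eq_right hb
    have h3 : min a b = a := min_eq_left (h.le.trans hb)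
    have h4 : min a' b = a' := min_eq_left hb
    rw [mixOp, mixOp, h1, h2, h3, h4]
    gcongr
  · have hM : max a b + 1 ≤ max a' b := by
      rw [max_eq_left hb.le]
      exact Order.add_one_le_of_lt (max_lt h hb)
    have hm : min a b < max a b + 1 := Order.lt_add_one_iff.2 min_le_max
    calc mixOp a b < (max a b + 1) * max a b + (max a b + 1) := by
          rw [mixOp]; gcongr
      _ = (max a b + 1) * (max a b + 1) := by rw [mul_add_one]
      _ ≤ (max a' b + 1) * max a' b := by
          gcongr
      _ ≤ mixOp a' b := le_self_add

theorem mixOp_strictMono_right (a : Ordinal.{0}) : StrictMono (mixOp a) := by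
  intro b b' h
  rw [mixOp_comm a b, mixOp_comm a b']
  exact mixOp_strictMono_left a h

theorem mixOp_le_mixOp {a a' b b' : Ordinal.{0}} (ha : a ≤ a') (hb : b ≤ b') :
    mixOp a b ≤ mixOp a' b' :=
  ((mixOp_strictMono_left b).monotone ha).trans ((mixOp_strictMono_right a').monotone hb)

open Ordinal in
theorem isPrincipal_mixOp {o : Ordinal.{0}} (ho : IsPrincipal (· * ·) o) (h : ω ≤ o) :
    IsPrincipal mixOp o := by
  have h2 : 2 < o := (natCast_lt_omega0 2).trans_le h
  have hadd : IsPrincipal (· + ·) o := isPrincipal_add_of_isPrincipal_mul ho h2.ne'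
  have h1 : 1 < o := by simpa using (natCast_lt_omega0 1).trans_le h
  intro a b ha hb
  have hm : max a b < o := max_lt ha hb
  exact hadd (ho (hadd hm h1) hm) ((min_le_left _ _).trans_lt ha)

/-- The iterated `mixOp` of a finite family of ordinals. -/
noncomputable def mixSum : (n : ℕ) → (Fin n → Ordinal.{0}) → Ordinal.{0}
  | 0, _ => 0
  | n + 1, f => mixOp (f 0) (mixSum n fun i => f i.succ)

theorem mixSum_le_mixSum : ∀ {n : ℕ} {f g : Fin n → Ordinal.{0}}, (∀ i, f i ≤ g i) →
    mixSum n f ≤ mixSum n g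
  | 0, _, _, _ => le_rfl
  | _ + 1, _, _, h => mixOp_le_mixOp (h 0) (mixSum_le_mixSum fun i => h i.succ)

theorem mixSum_lt_mixSum : ∀ {n : ℕ} {f g : Fin n → Ordinal.{0}}, (∀ i, f i ≤ g i) →
    (∃ i, f i < g i) → mixSum n f < mixSum n g
  | 0, _, _, _, ⟨i, _⟩ => i.elim0
  | n + 1, f, g, h, ⟨i, hi⟩ => by
    induction i using Fin.cases with
    | zero =>
      exact (mixOp_strictMono_left _ hi).trans_le
        (mixOp_le_mixOp le_rfl (mixSum_le_mixSum fun i => h i.succ))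
    | succ j =>
      exact (mixOp_strictMono_right _ (mixSum_lt_mixSum (fun i => h i.succ) ⟨j, hi⟩)).trans_le
        (mixOp_le_mixOp (h 0) le_rfl)

open Ordinal in
theorem mixSum_lt {o : Ordinal.{0}} (ho : IsPrincipal mixOp o) (h0 : 0 < o) :
    ∀ {n : ℕ} {f : Fin n → Ordinal.{0}}, (∀ i, f i < o) → mixSum n f < o
  | 0, _, _ => h0
  | _ + 1, _, h => ho (h 0) (mixSum_lt ho h0 fun i => h i.succ)

/-! ### Finite Veblen levels -/

open Ordinal in
/-- The function `α ↦ φ_m(ω ^ α)`. -/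
noncomputable def veblenOpow (m : ℕ) (a : Ordinal.{0}) : Ordinal.{0} := veblen m (ω ^ a)

open Ordinal in
theorem isNormal_veblenOpow (m : ℕ) : Order.IsNormal (veblenOpow m) :=
  (isNormal_veblen m).comp (isNormal_opow one_lt_omega0)

open Ordinal in
theorem omega0_opow_veblenOpow_succ (m : ℕ) (a : Ordinal.{0}) :
    ω ^ veblenOpow (m + 1) a = veblenOpow (m + 1) a := by
  have h := veblen_veblen_of_lt (o₁ := 0) (o₂ := ((m + 1 : ℕ) : Ordinal.{0}))
    (by simp) (ω ^ a)
  simpa [veblenOpow] using h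

open Ordinal in
theorem omega0_le_veblenOpow (m : ℕ) (a : Ordinal.{0}) : ω ≤ veblenOpow m a :=
  calc ω = ω ^ (1 : Ordinal) := (opow_one _).symm
    _ ≤ ω ^ (ω ^ a) := opow_le_opow_right omega0_pos (Order.one_le_iff_pos.2 (opow_pos _ omega0_pos))
    _ = veblen 0 (ω ^ a) := by simp
    _ ≤ veblenOpow m a := veblen_left_monotone (ω ^ a) zero_le

open Ordinal in
theorem isPrincipal_mul_veblenOpow : ∀ (m : ℕ) (a : Ordinal.{0}),
    IsPrincipal (· * ·) (veblenOpow m a)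
  | 0, a => by
    have : veblenOpow 0 a = ω ^ ω ^ a := by simp [veblenOpow]
    rw [this]
    exact isPrincipal_mul_omega0_opow_opow a
  | m + 1, a => by
    rw [← omega0_opow_veblenOpow_succ, ← omega0_opow_veblenOpow_succ]
    exact isPrincipal_mul_omega0_opow_opow _

theorem isPrincipal_mixOp_veblenOpow (m : ℕ) (a : Ordinal.{0}) :
    Ordinal.IsPrincipal mixOp (veblenOpow m a) :=
  isPrincipal_mixOp (isPrincipal_mul_veblenOpow m a) (omega0_le_veblenOpow m a)

theorem veblenOpow_pos (m : ℕ) (a : Ordinal.{0}) : 0 < veblenOpow m a :=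
  Ordinal.omega0_pos.trans_le (omega0_le_veblenOpow m a)

open Ordinal in
theorem isPrincipal_add_veblenOpow (m : ℕ) (a : Ordinal.{0}) :
    IsPrincipal (· + ·) (veblenOpow m a) :=
  isPrincipal_add_of_isPrincipal_mul (isPrincipal_mul_veblenOpow m a)
    ((natCast_lt_omega0 2).trans_le (omega0_le_veblenOpow m a)).ne'

open Ordinal in
theorem omega0_opow_lt_veblen_succ {m : ℕ} {a b : Ordinal.{0}} (h : b < veblen (m + 1 : ℕ) a) :
    ω ^ b < veblen (m + 1 : ℕ) a := by
  have h0 := veblen_veblen_of_lt (o₁ := 0) (o₂ := ((m + 1 : ℕ) : Ordinal.{0})) (by simp) a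
  rw [← h0]
  simpa using (isNormal_opow one_lt_omega0).strictMono h

-- A value of φ_{m+1} is fixed by φ_m and by ω ^ ·, so the ordinals below it are closed under both.
open Ordinal in
theorem veblenOpow_lt_veblen_succ {m : ℕ} {a b : Ordinal.{0}} (h : b < veblen (m + 1 : ℕ) a) :
    veblenOpow m b < veblen (m + 1 : ℕ) a := by
  rw [← veblen_veblen_of_lt (o₁ := (m : Ordinal.{0})) (o₂ := ((m + 1 : ℕ) : Ordinal.{0}))
    (by exact_mod_cast m.lt_succ_self) a]
  exact veblen_right_strictMono _ (omega0_opow_lt_veblen_succ h)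

open Ordinal in
theorem veblenOpow_add_opow_lt_succ {m : ℕ} {a b c : Ordinal.{0}} (hb : b < veblenOpow (m + 1) a)
    (hc : c < veblenOpow (m + 1) a) : veblenOpow m (b + ω ^ c) < veblenOpow (m + 1) a :=
  veblenOpow_lt_veblen_succ
    (isPrincipal_add_veblenOpow (m + 1) a hb (omega0_opow_lt_veblen_succ hc))

theorem le_veblenOpow (m : ℕ) (a : Ordinal.{0}) : a ≤ veblenOpow m a :=
  (isNormal_veblenOpow m).strictMono.le_apply

open Ordinal in
theorem exists_lt_veblenOpow_add {m : ℕ} {k a s : Ordinal.{0}} (hs : s ≠ 0)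
    (h : k < veblenOpow m (a + ω ^ s)) : ∃ z < ω ^ s, k < veblenOpow m (a + z) :=
  (((isNormal_veblenOpow m).comp (isNormal_add_right a)).lt_iff_exists_lt
    (isSuccLimit_opow_left isSuccLimit_omega0 hs)).1 h

/-! ### Well-ordered sets of reals and fusion sets -/

open Filter Topology in
theorem isWF_of_forall_exists_gap {S : Set ℝ} (hb : BddBelow S)
    (h : ∀ x : ℝ, ∃ ε > 0, ∀ y ∈ S, x < y → x + ε ≤ y) : S.IsWF := by
  rw [Set.isWF_iff_no_descending_seq]
  intro f hf hS
  have hbd : BddBelow (Set.range f) := hb.mono (Set.range_subset_iff.2 hS)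
  have hlim := tendsto_atTop_ciInf hf.antitone hbd
  obtain ⟨ε, hε, hgap⟩ := h (⨅ i, f i)
  obtain ⟨N, hN⟩ := (hlim.eventually (gt_mem_nhds (lt_add_of_pos_right _ hε))).exists
  have h1 : ⨅ i, f i < f N := (ciInf_le hbd (N + 1)).trans_lt (hf N.lt_succ_self)
  exact absurd (hgap _ (hS N) h1) (not_le.2 hN)

theorem Set.IsWF.exists_gap {S : Set ℝ} (hS : S.IsWF) (x : ℝ) :
    ∃ ε > 0, ∀ y ∈ S, x < y → x + ε ≤ y := by
  by_cases hne : (S ∩ Set.Ioi x).Nonempty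
  · have hW : (S ∩ Set.Ioi x).IsWF := hS.mono Set.inter_subset_left
    refine ⟨hW.min hne - x, sub_pos.2 (hW.min_mem hne).2, fun y hy hxy => ?_⟩
    have := hW.min_le hne ⟨hy, hxy⟩
    linarith
  · exact ⟨1, one_pos, fun y hy hxy => absurd ⟨y, hy, hxy⟩ hne⟩

theorem Set.IsWF.closure_real {S : Set ℝ} (hS : S.IsWF) (hb : BddBelow S) :
    (closure S).IsWF := by
  refine isWF_of_forall_exists_gap hb.closure fun x => ?_
  obtain ⟨ε, hε, h⟩ := hS.exists_gap x
  refine ⟨ε, hε, fun y hy hxy => ?_⟩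
  by_contra! hlt
  obtain ⟨z, ⟨hz1, hz2⟩, hz⟩ := mem_closure_iff.1 hy (Set.Ioo x (x + ε)) isOpen_Ioo ⟨hxy, hlt⟩
  exact absurd (h z hz hz1) (not_le.2 hz2)

/-- A set of nonnegative reals each of whose nonzero elements `z` admits elements
`y_1, …, y_n < z` of the set whose distances to `z` add up to `1`. -/
structure IsFusionSet (n : ℕ) (F : Set ℝ) : Prop where
  nonneg : ∀ z ∈ F, 0 ≤ z
  split : ∀ z ∈ F, z ≠ 0 → ∃ y : Fin n → ℝ, (∀ i, y i ∈ F) ∧ (∀ i, y i < z) ∧ ∑ i, (z - y i) = 1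

/-- Without truncation the sum of the y_i - e is n(z - e) - 1. Some y_j is at most e, as otherwise
the distances would add up to less than 1; truncating each of the other n - 1 entries at e loses at
most z - e. -/
theorem sum_min_bounds {n : ℕ} {z e : ℝ} {y : Fin n → ℝ} (hez : e ≤ z) (hy : ∀ i, y i < z)
    (hsum : ∑ i, (z - y i) = 1) (hn : n * (z - e) < 1) :
    z - e ≤ ∑ i, (min (y i) e - e) + 1 ∧ ∑ i, (min (y i) e - e) + 1 ≤ n * (z - e) := by
  have hs : ∑ i, (y i - e) = n * (z - e) - 1 := by
    have : ∑ i, (y i - e) = ∑ i : Fin n, (z - e) - ∑ i, (z - y i) := by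
      rw [← Finset.sum_sub_distrib]; exact Finset.sum_congr rfl fun i _ => by ring
    rw [this, hsum]; simp [mul_sub]
  constructor
  · obtain ⟨j, hj⟩ : ∃ j, y j ≤ e := by
      by_contra! hcon
      have : ∑ i, (z - y i) ≤ ∑ i : Fin n, (z - e) :=
        Finset.sum_le_sum fun i _ => by linarith [hcon i]
      rw [hsum] at this
      simp at this
      linarith
    have h1 : ∑ i, (min (y i) e - e) ≥ ∑ i, (y i - e) - ∑ i ∈ Finset.univ.erase j, (z - e) := by
      rw [← Finset.add_sum_erase _ _ (Finset.mem_univ j),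
        ← Finset.add_sum_erase _ (fun i => y i - e) (Finset.mem_univ j), min_eq_left hj,
        add_sub_assoc, ← Finset.sum_sub_distrib]
      gcongr _ + ?_
      refine Finset.sum_le_sum fun i _ => ?_
      have := hy i
      rcases min_cases (y i) e with h | h <;> linarith
    have hcard : ((Finset.univ.erase j).card : ℝ) = n - 1 := by
      rw [Finset.card_erase_of_mem (Finset.mem_univ j), Finset.card_univ, Fintype.card_fin,
        Nat.cast_pred (Fin.pos j)]
    rw [Finset.sum_const, nsmul_eq_mul, hcard] at h1
    linarith
  · have : ∑ i, (min (y i) e - e) ≤ ∑ i, (y i - e) :=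
      Finset.sum_le_sum fun i _ => by linarith [min_le_left (y i) e]
    linarith

/-- Let e be the least right accumulation point and z_m ∈ F tend to e from the right. Truncated at
e, the splittings of the z_m live in a well-ordered set, so along a subsequence their sums do not
decrease; by `sum_min_bounds` these sums, suitably shifted, are positive and tend to 0. -/
theorem IsFusionSet.isWF {n : ℕ} {F : Set ℝ} (hF : IsFusionSet n F) : F.IsWF := by
  have hbF : BddBelow F := ⟨0, fun z hz => hF.nonneg z hz⟩
  refine isWF_of_forall_exists_gap hbF ?_
  by_contra! hcon
  set R : Set ℝ := {x | ∀ ε > 0, ∃ y ∈ F, x < y ∧ y < x + ε} with hR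
  have hRne : R.Nonempty := hcon
  have hRb : BddBelow R := by
    refine ⟨0, fun x hx => ?_⟩
    by_contra! h0
    obtain ⟨y, hy, _, h2⟩ := hx (-x) (by linarith)
    linarith [hF.nonneg y hy]
  set e := sInf R with he
  have heR : e ∈ R := by
    intro ε hε
    obtain ⟨x, hx, hxe⟩ := exists_lt_of_csInf_lt hRne (show sInf R < e + ε by linarith)
    rcases (csInf_le hRb hx).eq_or_lt with h | h
    · obtain ⟨y, hy, h1, h2⟩ := hx ε hε
      rw [← h, ← he] at h1 h2
      exact ⟨y, hy, h1, h2⟩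
    · obtain ⟨y, hy, h1, h2⟩ := hx (e + ε - x) (by linarith)
      exact ⟨y, hy, h.trans h1, by linarith⟩
  set W : Set ℝ := insert e (F ∩ Set.Iic e) with hW
  have hWF : W.IsWF := by
    refine Set.IsWF.insert ?_ e
    refine isWF_of_forall_exists_gap (hbF.mono Set.inter_subset_left) fun x => ?_
    rcases lt_or_ge x e with hx | hx
    · have hxR : x ∉ R := fun h => absurd (csInf_le hRb h) (not_le.2 hx)
      simp only [hR, Set.mem_ofPred_eq, not_forall, not_exists, not_and, not_lt] at hxR
      obtain ⟨ε, hε, h⟩ := hxR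
      exact ⟨ε, hε, fun y hy hxy => h y hy.1 hxy⟩
    · exact ⟨1, one_pos, fun y hy hxy => absurd hy.2 (not_le.2 (hx.trans_lt hxy))⟩
  have he0 : 0 ≤ e := le_csInf hRne fun x hx => by
    by_contra! h0
    obtain ⟨y, hy, _, h2⟩ := hx (-x) (by linarith)
    linarith [hF.nonneg y hy]
  -- The factor n + 1 gives n(z - e) < 1 / (m + 1), and keeps the denominator nonzero even for n =
  -- 0.
  have hchoose : ∀ m : ℕ, ∃ z, e < z ∧ z < e + 1 / ((n + 1) * (m + 1)) ∧ ∃ y : Fin n → ℝ,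
      (∀ i, y i ∈ F) ∧ (∀ i, y i < z) ∧ ∑ i, (z - y i) = 1 := by
    intro m
    obtain ⟨z, hz, h1, h2⟩ := heR (1 / ((n + 1) * (m + 1))) (by positivity)
    exact ⟨z, h1, h2, hF.split z hz (he0.trans_lt h1).ne'⟩
  choose z hez hzlt y hyF hyz hsum using hchoose
  have hpwo : (Set.pi Set.univ fun _ : Fin n => W).IsPWO :=
    Set.IsPWO.pi fun _ => hWF.isPWO
  obtain ⟨g, hg⟩ := hpwo.exists_monotone_subseq (f := fun m i => min (y m i) e) (by
    intro m i _
    rcases min_cases (y m i) e with ⟨h, h'⟩ | ⟨h, _⟩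
    · simp only [h]; exact Or.inr ⟨hyF m i, h'⟩
    · simp only [h]; exact Or.inl rfl)
  have hnz : ∀ m : ℕ, (n : ℝ) * (z m - e) < 1 / (m + 1) := by
    intro m
    have h1 : z m - e < 1 / ((n + 1) * (m + 1)) := by linarith [hzlt m]
    calc (n : ℝ) * (z m - e) ≤ (n + 1) * (z m - e) := by nlinarith [hez m]
      _ < (n + 1) * (1 / ((n + 1) * (m + 1))) := by gcongr
      _ = 1 / (m + 1) := by field_simp
  have hnz1 : ∀ m : ℕ, (n : ℝ) * (z m - e) < 1 := fun m =>
    (hnz m).trans_le (by rw [div_le_one (by positivity)]; linarith [(m.cast_nonneg : (0 : ℝ) ≤ m)])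
  have hb := fun m => sum_min_bounds (hez m).le (hyz m) (hsum m) (hnz1 m)
  obtain ⟨m, hm⟩ := exists_nat_one_div_lt (sub_pos.2 (hez (g 0)))
  have hmono : ∑ i, (min (y (g 0) i) e - e) ≤ ∑ i, (min (y (g m) i) e - e) :=
    Finset.sum_le_sum fun i _ => by
      have := hg (Nat.zero_le m) i
      simp only [Function.comp_apply] at this
      linarith
  have hgm : (1 : ℝ) / ((g m : ℕ) + 1) ≤ 1 / (m + 1) := by
    gcongr
    exact g.strictMono.le_apply
  linarith [(hb (g 0)).1, (hb (g m)).2, hnz (g m)]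

/-! ### Splittings over a well-ordered set -/

/-- The tuples of elements of `C` that are at most `z` and whose distances to `z` add up to `1`. -/
def splittings (C : Set ℝ) (n : ℕ) (z : ℝ) : Set (Fin n → ℝ) :=
  {y | (∀ i, y i ∈ C) ∧ (∀ i, y i ≤ z) ∧ ∑ i, (z - y i) = 1}

/-- Comparable splittings of z coincide because their sums agree, and an antichain in a partially
well-ordered set is finite. -/
theorem finite_splittings {C : Set ℝ} (hC : C.IsWF) (n : ℕ) (z : ℝ) :
    (splittings C n z).Finite := by
  have hpwo : (splittings C n z).IsPWO :=
    (Set.IsPWO.pi fun _ : Fin n => hC.isPWO).mono fun y hy i _ => hy.1 i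
  refine IsAntichain.finite_of_partiallyWellOrderedOn (r := (· ≤ ·)) ?_ hpwo
  intro y hy y' hy' hne hle
  refine hne (funext fun i => ?_)
  have h : ∑ i, (y' i - y i) = 0 := by
    have : ∑ i, (y' i - y i) = ∑ i, (z - y i) - ∑ i, (z - y' i) := by
      rw [← Finset.sum_sub_distrib]; exact Finset.sum_congr rfl fun i _ => by ring
    rw [this, hy.2.2, hy'.2.2, sub_self]
  have := (Finset.sum_eq_zero_iff_of_nonneg fun i _ => sub_nonneg.2 (hle i)).1 h i (Finset.mem_univ i)
  linarith

-- Compactness: splittings of points tending to z from the left have a coordinatewise nondecreasing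
-- subsequence, whose limit is a splitting of z lying above them.
open Filter Topology in
theorem exists_splitting_near {C : Set ℝ} (hC : C.IsWF) (hcl : IsClosed C) (n : ℕ) (z : ℝ) {ε : ℝ}
    (hε : 0 < ε) : ∃ a < z, ∀ w, a < w → w ≤ z → ∀ y' ∈ splittings C n w,
      ∃ y ∈ splittings C n z, ∀ i, y i - ε < y' i ∧ y' i ≤ y i := by
  by_contra! hcon
  have hchoose : ∀ m : ℕ, ∃ w, z - 1 / (m + 1) < w ∧ w ≤ z ∧ ∃ y' ∈ splittings C n w,
      ∀ y ∈ splittings C n z, ∃ i, y i - ε < y' i → y i < y' i := fun m =>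
    hcon (z - 1 / (m + 1)) (sub_lt_self _ (by positivity))
  choose w hw hwz y' hy' hbad using hchoose
  obtain ⟨g, hg⟩ := (Set.IsPWO.pi fun _ : Fin n => hC.isPWO).exists_monotone_subseq (f := y')
    (fun m i _ => (hy' m).1 i)
  have hwlim : Tendsto w atTop (𝓝 z) := by
    refine tendsto_of_tendsto_of_tendsto_of_le_of_le ?_ tendsto_const_nhds (fun m => (hw m).le) hwz
    simpa using tendsto_const_nhds.sub (tendsto_one_div_add_atTop_nhds_zero_nat (𝕜 := ℝ))
  have hbd : ∀ i, BddAbove (Set.range fun m => y' (g m) i) := fun i =>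
    ⟨z, by rintro _ ⟨m, rfl⟩; exact ((hy' (g m)).2.1 i).trans (hwz _)⟩
  set y : Fin n → ℝ := fun i => ⨆ m, y' (g m) i with hydef
  have hlim : ∀ i, Tendsto (fun m => y' (g m) i) atTop (𝓝 (y i)) := fun i =>
    tendsto_atTop_ciSup (fun _ _ h => hg h i) (hbd i)
  have hwg : Tendsto (fun m => w (g m)) atTop (𝓝 z) := hwlim.comp g.strictMono.tendsto_atTop
  have hy : y ∈ splittings C n z := by
    refine ⟨fun i => hcl.mem_of_tendsto (hlim i) (Eventually.of_forall fun m => (hy' (g m)).1 i),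
      fun i => ciSup_le fun m => ((hy' (g m)).2.1 i).trans (hwz _), ?_⟩
    have h1 : Tendsto (fun m => ∑ i, (w (g m) - y' (g m) i)) atTop (𝓝 (∑ i, (z - y i))) :=
      tendsto_finsetSum _ fun i _ => hwg.sub (hlim i)
    have h2 : (fun m => ∑ i, (w (g m) - y' (g m) i)) = fun _ => 1 :=
      funext fun m => (hy' (g m)).2.2
    rw [h2] at h1
    exact tendsto_nhds_unique h1 tendsto_const_nhds
  have hev : ∀ᶠ m in atTop, ∀ i, y i - ε < y' (g m) i :=
    eventually_all.2 fun i => (hlim i).eventually (lt_mem_nhds (sub_lt_self _ hε))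
  obtain ⟨m, hm⟩ := hev.exists
  obtain ⟨i, hi⟩ := hbad (g m) y hy
  exact absurd (hi (hm i)) (not_lt.2 (le_ciSup (hbd i) m))

/-! ### Left rank -/

/-- The left rank of `z` in `C` is at most `g`: near `z` and to its left, all points of `C` have
left rank less than `g`. -/
def LeftRankLE (C : Set ℝ) (g : Ordinal.{0}) (z : ℝ) : Prop :=
  ∃ a < z, ∀ w ∈ C, a < w → w < z → ∃ d : Ordinal.{0}, ∃ _ : d < g, LeftRankLE C d w
termination_by g

theorem leftRankLE_iff {C : Set ℝ} {g : Ordinal.{0}} {z : ℝ} : LeftRankLE C g z ↔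
    ∃ a < z, ∀ w ∈ C, a < w → w < z → ∃ d < g, LeftRankLE C d w := by
  rw [LeftRankLE]
  simp only [exists_prop]

theorem exists_leftRankLE {C : Set ℝ} (hC : C.IsWF) (z : ℝ) : ∃ g, LeftRankLE C g z := by
  have step : ∀ z, (∀ w ∈ C, w < z → ∃ g, LeftRankLE C g w) → ∃ g, LeftRankLE C g z := by
    intro z h
    choose f hf using h
    refine ⟨⨆ w : {w // w ∈ C ∧ w < z}, (f w.1 w.2.1 w.2.2 + 1),
      leftRankLE_iff.2 ⟨z - 1, by linarith, fun w hw _ hwz => ⟨f w hw hwz, ?_, hf w hw hwz⟩⟩⟩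
    exact (Order.lt_add_one_iff.2 le_rfl).trans_le
      (Ordinal.le_iSup (fun w : {w // w ∈ C ∧ w < z} => f w.1 w.2.1 w.2.2 + 1) ⟨w, hw, hwz⟩)
  exact step z fun w hw _ => Set.WellFoundedOn.induction hC hw fun y _ ih => step y ih

/-- The left rank of `z` in `C`. -/
noncomputable def leftRank (C : Set ℝ) (z : ℝ) : Ordinal.{0} := sInf {g | LeftRankLE C g z}

theorem leftRankLE_leftRank {C : Set ℝ} (hC : C.IsWF) (z : ℝ) :
    LeftRankLE C (leftRank C z) z :=
  csInf_mem (exists_leftRankLE hC z)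

theorem leftRank_le_of_leftRankLE {C : Set ℝ} {g : Ordinal.{0}} {z : ℝ} (h : LeftRankLE C g z) :
    leftRank C z ≤ g := csInf_le' h

theorem exists_leftRank_lt {C : Set ℝ} (hC : C.IsWF) (z : ℝ) :
    ∃ a < z, ∀ w ∈ C, a < w → w < z → leftRank C w < leftRank C z := by
  obtain ⟨a, ha, h⟩ := leftRankLE_iff.1 (leftRankLE_leftRank hC z)
  refine ⟨a, ha, fun w hw h1 h2 => ?_⟩
  obtain ⟨d, hd, hdw⟩ := h w hw h1 h2
  exact (leftRank_le_of_leftRankLE hdw).trans_lt hd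

theorem leftRank_le {C : Set ℝ} (hC : C.IsWF) {g : Ordinal.{0}} {z a : ℝ} (ha : a < z)
    (h : ∀ w ∈ C, a < w → w < z → leftRank C w < g) : leftRank C z ≤ g :=
  leftRank_le_of_leftRankLE (leftRankLE_iff.2
    ⟨a, ha, fun w hw h1 h2 => ⟨_, h w hw h1 h2, leftRankLE_leftRank hC w⟩⟩)

/-- Strict bounds become uniform by induction along C: just left of c the ranks are below that of c,
and further left induction applies. Closedness reduces an arbitrary cut to a point of C. -/
theorem exists_leftRank_bound {C : Set ℝ} (hC : C.IsWF) (hcl : IsClosed C) {X : Ordinal.{0}}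
    (hX : 0 < X) {b : ℝ} (hb : ∀ w ∈ C, w ≤ b → leftRank C w < X) :
    ∃ k < X, ∀ w ∈ C, w ≤ b → leftRank C w ≤ k := by
  have step : ∀ a, (∀ c ∈ C, c ≤ a → ∃ k < X, ∀ w ∈ C, w ≤ c → leftRank C w ≤ k) →
      ∃ k < X, ∀ w ∈ C, w ≤ a → leftRank C w ≤ k := by
    intro a h
    by_cases hne : (C ∩ Set.Iic a).Nonempty
    · have hbd : BddAbove (C ∩ Set.Iic a) := bddAbove_Iic.mono Set.inter_subset_right
      have hmem := (hcl.inter isClosed_Iic).csSup_mem hne hbd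
      obtain ⟨k, hk, hkw⟩ := h _ hmem.1 hmem.2
      exact ⟨k, hk, fun w hw hwa => hkw w hw (le_csSup hbd ⟨hw, hwa⟩)⟩
    · exact ⟨0, hX, fun w hw hwa => absurd ⟨w, hw, hwa⟩ hne⟩
  have key : ∀ c ∈ C, c ≤ b → ∃ k < X, ∀ w ∈ C, w ≤ c → leftRank C w ≤ k := by
    intro c hc
    refine Set.WellFoundedOn.induction hC hc 
      (P := fun c => c ≤ b → ∃ k < X, ∀ w ∈ C, w ≤ c → leftRank C w ≤ k) fun c hc ih hcb => ?_
    obtain ⟨a, ha, hac⟩ := exists_leftRank_lt hC c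
    obtain ⟨k, hk, hkw⟩ := step a fun c' hc' hca =>
      ih c' hc' (hca.trans_lt ha) ((hca.trans ha.le).trans hcb)
    refine ⟨max k (leftRank C c), max_lt hk (hb c hc hcb), fun w hw hwc => ?_⟩
    rcases le_or_gt w a with h | h
    · exact (hkw w hw h).trans (le_max_left _ _)
    · rcases hwc.eq_or_lt with rfl | h'
      · exact le_max_right _ _
      · exact (hac w hw h h').le.trans (le_max_right _ _)
  exact step b key

/-! ### The closure and the local comparison of splittings -/

/-- A closed well-ordered set of nonnegative reals all of whose nonzero elements have splittings. -/
structure IsClosedFusionSet (n : ℕ) (C : Set ℝ) : Prop where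
  isWF : C.IsWF
  isClosed : IsClosed C
  nonneg : ∀ z ∈ C, 0 ≤ z
  nonempty : ∀ z ∈ C, z ≠ 0 → (splittings C n z).Nonempty

/-- There is a gap of F to the right of z, so points f ≤ z of F approach z; a splitting of such an f
is dominated by one of z. -/
theorem IsFusionSet.isClosedFusionSet_closure {n : ℕ} {F : Set ℝ} (hF : IsFusionSet n F) :
    IsClosedFusionSet n (closure F) := by
  have hb : BddBelow F := ⟨0, fun z hz => hF.nonneg z hz⟩
  have hwf := hF.isWF.closure_real hb
  have hnn : ∀ z ∈ closure F, 0 ≤ z := fun z hz =>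
    closure_minimal (fun y hy => hF.nonneg y hy) isClosed_Ici hz
  refine ⟨hwf, isClosed_closure, hnn, fun z hz hz0 => ?_⟩
  obtain ⟨a, ha, hnear⟩ := exists_splitting_near hwf isClosed_closure n z one_pos
  obtain ⟨ε, hε, hgap⟩ := hF.isWF.exists_gap z
  have hz0' : 0 < z := lt_of_le_of_ne (hnn z hz) hz0.symm
  obtain ⟨f, ⟨hf1, hf2⟩, hf⟩ := mem_closure_iff.1 hz (Set.Ioo (max a 0) (z + ε)) isOpen_Ioo
    ⟨max_lt ha hz0', by linarith⟩
  have hfz : f ≤ z := by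
    by_contra! h
    exact absurd (hgap f hf h) (not_le.2 hf2)
  obtain ⟨y, hyF, hyf, hs⟩ := hF.split f hf ((le_max_right _ _).trans_lt hf1).ne'
  obtain ⟨y', hy', _⟩ := hnear f ((le_max_left _ _).trans_lt hf1) hfz y
    ⟨fun i => subset_closure (hyF i), fun i => (hyf i).le, hs⟩
  exact ⟨y', hy'⟩

/-- To the left of `z` and right of `a`, splittings are dominated by splittings of `z`. -/
structure IsNear (C : Set ℝ) (n : ℕ) (z a : ℝ) : Prop where
  lt : a < z
  nonempty : ∀ w ∈ C, a < w → w < z → (splittings C n w).Nonempty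
  dom : ∀ w ∈ C, a < w → w < z → ∀ y' ∈ splittings C n w, ∃ y ∈ splittings C n z, ∀ i,
    y' i ≤ y i ∧ (y i < z → y' i < w) ∧ (y' i < y i → leftRank C (y' i) < leftRank C (y i))

open Filter Topology in
theorem IsClosedFusionSet.exists_isNear {n : ℕ} {C : Set ℝ} (hC : IsClosedFusionSet n C) (z : ℝ) :
    ∃ a, IsNear C n z a := by
  choose A hA hAr using exists_leftRank_lt hC.isWF
  have hfin := finite_splittings hC.isWF n z
  -- A coordinate that moves left by less than ε enters the neighbourhood of y i where left ranks
  -- drop.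
  have h1 : ∀ᶠ ε in 𝓝[>] (0 : ℝ), ∀ y ∈ splittings C n z, ∀ i, ε < y i - A (y i) :=
    (eventually_all_finite hfin).2 fun y _ => eventually_all.2 fun i =>
      eventually_nhdsWithin_of_eventually_nhds (gt_mem_nhds (sub_pos.2 (hA _)))
  obtain ⟨ε, hε1, hε⟩ := (h1.and self_mem_nhdsWithin).exists
  obtain ⟨a₀, ha₀, hnear⟩ := exists_splitting_near hC.isWF hC.isClosed n z hε
  have h2 : ∀ᶠ a in 𝓝[<] z, ∀ y ∈ splittings C n z, ∀ i, y i < z → y i < a :=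
    (eventually_all_finite hfin).2 fun y _ => eventually_all.2 fun i =>
      eventually_nhdsWithin_of_eventually_nhds (by
        by_cases h : y i < z
        · filter_upwards [lt_mem_nhds h] with a ha _ using ha
        · exact Eventually.of_forall fun a ha => absurd ha h)
  have h3 : ∀ᶠ a in 𝓝[<] z, 0 < z → 0 < a :=
    eventually_nhdsWithin_of_eventually_nhds (by
      by_cases h : 0 < z
      · filter_upwards [lt_mem_nhds h] with a ha _ using ha
      · exact Eventually.of_forall fun a ha => absurd ha h)
  have h4 : ∀ᶠ a in 𝓝[<] z, a₀ < a := eventually_nhdsWithin_of_eventually_nhds (lt_mem_nhds ha₀)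
  obtain ⟨a, ⟨⟨ha2, ha3⟩, ha4⟩, haz⟩ := (((h2.and h3).and h4).and self_mem_nhdsWithin).exists
  refine ⟨a, haz, fun w hw haw hwz => ?_, fun w hw haw hwz y' hy' => ?_⟩
  · exact hC.nonempty w hw ((ha3 ((hC.nonneg w hw).trans_lt hwz)).trans haw).ne'
  · obtain ⟨y, hy, hyy⟩ := hnear w (ha4.trans haw) hwz.le y' hy'
    refine ⟨y, hy, fun i => ⟨(hyy i).2, fun h => ?_, fun h => ?_⟩⟩
    · exact ((hyy i).2.trans_lt (ha2 y hy i h)).trans haw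
    · exact hAr _ _ (hy'.1 i) (by linarith [hε1 y hy i, (hyy i).1]) h

/-! ### Bounding left ranks by Veblen functions -/

open Classical in
/-- The number of entries of the tuple `y` that are equal to `z`. -/
noncomputable def eqCount {n : ℕ} (z : ℝ) (y : Fin n → ℝ) : ℕ :=
  (Finset.univ.filter fun i => y i = z).card

open Classical in
/-- The combined left rank of the entries of the tuple `y` that are less than `z`. -/
noncomputable def outerRank {n : ℕ} (C : Set ℝ) (z : ℝ) (y : Fin n → ℝ) : Ordinal.{0} :=
  mixSum n fun i => if y i < z then leftRank C (y i) else 0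

theorem outerRank_lt {n : ℕ} {C : Set ℝ} {z : ℝ} {y : Fin n → ℝ} {o : Ordinal.{0}}
    (ho : Ordinal.IsPrincipal mixOp o) (h0 : 0 < o) (h : ∀ i, y i < z → leftRank C (y i) < o) :
    outerRank C z y < o := by
  refine mixSum_lt ho h0 fun i => ?_
  split_ifs with hi
  exacts [h i hi, h0]

theorem eqCount_le_of_dom {n : ℕ} {z w : ℝ} {y y' : Fin n → ℝ} (hyz : ∀ i, y i ≤ z)
    (h : ∀ i, y i < z → y' i < w) : eqCount w y' ≤ eqCount z y := by
  refine Finset.card_le_card fun i => ?_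
  simp only [Finset.mem_filter, Finset.mem_univ, true_and]
  intro hi
  by_contra hne
  exact (h i (lt_of_le_of_ne (hyz i) hne)).ne hi

/-- If the number of equal entries does not drop, they occupy the same positions. The remaining
ranks cannot all persist: those entries would then be unmoved, and replacing z by w < z would shrink
the total distance below 1. -/
theorem outerRank_lt_of_dom {n : ℕ} {C : Set ℝ} {z w : ℝ} {y y' : Fin n → ℝ} (hwz : w < z)
    (hy : y ∈ splittings C n z) (hy' : y' ∈ splittings C n w)
    (h : ∀ i, y' i ≤ y i ∧ (y i < z → y' i < w) ∧
      (y' i < y i → leftRank C (y' i) < leftRank C (y i)))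
    (hc : eqCount z y ≤ eqCount w y') : outerRank C w y' < outerRank C z y := by
  classical
  have hsub : (Finset.univ.filter fun i => y' i = w) ⊆ Finset.univ.filter fun i => y i = z := by
    intro i
    simp only [Finset.mem_filter, Finset.mem_univ, true_and]
    intro hi
    by_contra hne
    exact ((h i).2.1 (lt_of_le_of_ne (hy.2.1 i) hne)).ne hi
  have heq := Finset.eq_of_subset_of_card_le hsub (by simpa [eqCount] using hc)
  have hiff : ∀ i, y' i = w ↔ y i = z := fun i => by
    have := Finset.ext_iff.1 heq i
    simpa using this
  have hlt : ∀ i, y' i < w ↔ y i < z := fun i => by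
    rw [(hy'.2.1 i).lt_iff_ne, (hy.2.1 i).lt_iff_ne, Ne, Ne, hiff i]
  have hle : ∀ i, leftRank C (y' i) ≤ leftRank C (y i) := fun i => by
    rcases (h i).1.eq_or_lt with h' | h'
    · rw [h']
    · exact ((h i).2.2 h').le
  refine mixSum_lt_mixSum (fun i => ?_) ?_
  · simp only [hlt i]
    split_ifs
    exacts [hle i, le_rfl]
  · by_contra! hcon
    have hsame : ∀ i, y i < z → y' i = y i := fun i hi => by
      have h1 := hcon i
      simp only [hlt i, hi, if_true] at h1
      by_contra hne
      exact absurd ((h i).2.2 (lt_of_le_of_ne (h i).1 hne)) (not_lt.2 h1)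
    have hterm : ∀ i ∈ Finset.univ, w - y' i ≤ z - y i := fun i _ => by
      rcases (hy.2.1 i).eq_or_lt with h' | h'
      · rw [(hiff i).2 h', h']; simp
      · rw [hsame i h']; linarith
    have hall := (Finset.sum_eq_sum_iff_of_le hterm).1 (hy'.2.2.trans hy.2.2.symm)
    have hzero : ∀ i, z - y i = 0 := fun i => by
      rcases (hy.2.1 i).eq_or_lt with h' | h'
      · rw [h', sub_self]
      · have := hall i (Finset.mem_univ i)
        rw [hsame i h'] at this
        linarith
    have := hy.2.2
    simp [hzero] at this

theorem leftRank_le_of_eqCount_eq_zero {n : ℕ} {C : Set ℝ} (hC : IsClosedFusionSet n C)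
    (s : Ordinal.{0}) : ∀ z : ℝ, (∀ y ∈ splittings C n z, eqCount z y = 0 ∧ outerRank C z y ≤ s) →
    leftRank C z ≤ s := by
  induction s using WellFoundedLT.induction with
  | ind s ih =>
    intro z hz
    obtain ⟨a, ha⟩ := hC.exists_isNear z
    refine leftRank_le hC.isWF ha.lt fun w hw haw hwz => ?_
    have hlt : ∀ y' ∈ splittings C n w, eqCount w y' = 0 ∧ outerRank C w y' < s := by
      intro y' hy'
      obtain ⟨y, hy, hyy⟩ := ha.dom w hw haw hwz y' hy'
      have hc := eqCount_le_of_dom hy.2.1 fun i => (hyy i).2.1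
      rw [(hz y hy).1] at hc
      exact ⟨Nat.le_zero.1 hc, (outerRank_lt_of_dom hwz hy hy' hyy
        ((hz y hy).1.le.trans (Nat.zero_le _))).trans_le (hz y hy).2⟩
    obtain ⟨y₀, hy₀, hmax⟩ := Set.exists_max_image _ (outerRank C w)
      (finite_splittings hC.isWF n w) (ha.nonempty w hw haw hwz)
    exact (ih _ (hlt y₀ hy₀).2 w fun y' hy' => ⟨(hlt y' hy').1, hmax y' hy'⟩).trans_lt
      (hlt y₀ hy₀).2

/-- Induction on s, the bound on the outer rank of splittings with m + 1 equal entries. At w left of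
z such splittings have outer rank less than s, or there are none and `low` applies. -/
theorem leftRank_le_veblenOpow_of_lower {n : ℕ} {C : Set ℝ} (hC : IsClosedFusionSet n C) (m : ℕ)
    (low : ∀ (x : Ordinal.{0}) (w a : ℝ), IsNear C n w a → (splittings C n w).Nonempty →
        (∀ v ∈ C, v < w → leftRank C v < veblenOpow m x) →
        (∀ y ∈ splittings C n w, eqCount w y < m + 1) → leftRank C w < veblenOpow m x) :
    ∀ (s ξ : Ordinal.{0}) (z a : ℝ), IsNear C n z a →
      (∀ w ∈ C, w ≤ a → leftRank C w < veblenOpow m ξ) →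
      (∀ y ∈ splittings C n z, eqCount z y ≤ m + 1 ∧ (eqCount z y = m + 1 → outerRank C z y ≤ s)) →
      leftRank C z ≤ veblenOpow m (ξ + Ordinal.omega0 ^ s) := by
  intro s
  induction s using WellFoundedLT.induction with
  | ind s ihs => ?_
  intro ξ z a ha hξ hz
  refine leftRank_le hC.isWF ha.lt fun w hw haw hwz => ?_
  revert haw hwz
  refine Set.WellFoundedOn.induction hC.isWF hw
    (P := fun w => a < w → w < z → leftRank C w < veblenOpow m (ξ + Ordinal.omega0 ^ s))
    fun w hw ih haw hwz => ?_
  have hbelow : ∀ v ∈ C, v < w → leftRank C v < veblenOpow m (ξ + Ordinal.omega0 ^ s) := by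
    intro v hv hvw
    rcases le_or_gt v a with hva | hva
    · exact (hξ v hv hva).trans_le ((isNormal_veblenOpow m).monotone le_self_add)
    · exact ih v hv hvw hva (hvw.trans hwz)
  obtain ⟨b, hb⟩ := hC.exists_isNear w
  by_cases hex : ∃ y' ∈ splittings C n w, eqCount w y' = m + 1
  · have hlt : ∀ y' ∈ splittings C n w, eqCount w y' ≤ m + 1 ∧
        (eqCount w y' = m + 1 → outerRank C w y' < s) := by
      intro y' hy'
      obtain ⟨y, hy, hyy⟩ := ha.dom w hw haw hwz y' hy'
      have hc := eqCount_le_of_dom hy.2.1 fun i => (hyy i).2.1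
      refine ⟨hc.trans (hz y hy).1, fun heq => ?_⟩
      exact (outerRank_lt_of_dom hwz hy hy' hyy (heq ▸ (hz y hy).1)).trans_le
        ((hz y hy).2 (le_antisymm (hz y hy).1 (heq ▸ hc)))
    obtain ⟨y₀, ⟨hy₀, hy₀c⟩, hmax⟩ := Set.exists_max_image
      {y' | y' ∈ splittings C n w ∧ eqCount w y' = m + 1} (outerRank C w)
      ((finite_splittings hC.isWF n w).subset fun _ h => h.1) hex
    have hs := (hlt y₀ hy₀).2 hy₀c
    obtain ⟨k, hk, hkw⟩ := exists_leftRank_bound hC.isWF hC.isClosed (veblenOpow_pos _ _)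
      fun v hv hvb => hbelow v hv (hvb.trans_lt hb.lt)
    -- The new start ξ + ζ absorbs the ranks found left of w; ζ + ω ^ s' < ω ^ s for s' < s, as ω ^
    -- s is additively principal.
    obtain ⟨ζ, hζ, hkζ⟩ := exists_lt_veblenOpow_add (pos_of_gt hs).ne' hk
    refine (ihs _ hs (ξ + ζ) w b hb (fun v hv hvb => (hkw v hv hvb).trans_lt hkζ) fun y hy =>
      ⟨(hlt y hy).1, fun heq => hmax y ⟨hy, heq⟩⟩).trans_lt
      ((isNormal_veblenOpow m).strictMono ?_)
    rw [add_assoc]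
    gcongr
    exact Ordinal.isPrincipal_add_omega0_opow s hζ
      ((Ordinal.isNormal_opow Ordinal.one_lt_omega0).strictMono hs)
  · refine low _ w b hb (ha.nonempty w hw haw hwz) hbelow fun y' hy' => ?_
    obtain ⟨y, hy, hyy⟩ := ha.dom w hw haw hwz y' hy'
    exact lt_of_le_of_ne ((eqCount_le_of_dom hy.2.1 fun i => (hyy i).2.1).trans (hz y hy).1)
      fun h => hex ⟨y', hy', h⟩

/-- Induction on m supplies the hypothesis `low`: values of `veblenOpow (m + 1)` are closed under
the bound obtained at level m, and those of `veblenOpow 0` under combining outer ranks. -/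
theorem leftRank_le_veblenOpow {n : ℕ} {C : Set ℝ} (hC : IsClosedFusionSet n C) : ∀ (m : ℕ)
    (s ξ : Ordinal.{0}) (z a : ℝ), IsNear C n z a →
      (∀ w ∈ C, w ≤ a → leftRank C w < veblenOpow m ξ) →
      (∀ y ∈ splittings C n z, eqCount z y ≤ m + 1 ∧ (eqCount z y = m + 1 → outerRank C z y ≤ s)) →
      leftRank C z ≤ veblenOpow m (ξ + Ordinal.omega0 ^ s) := by
  intro m
  induction m with
  | zero =>
    refine leftRank_le_veblenOpow_of_lower hC 0 fun x w a ha hne hw hcount => ?_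
    obtain ⟨y₀, hy₀, hmax⟩ := Set.exists_max_image _ (outerRank C w)
      (finite_splittings hC.isWF n w) hne
    exact (leftRank_le_of_eqCount_eq_zero hC _ w fun y hy =>
      ⟨Nat.lt_one_iff.1 (hcount y hy), hmax y hy⟩).trans_lt
      (outerRank_lt (isPrincipal_mixOp_veblenOpow _ x) (veblenOpow_pos _ x)
        fun i hi => hw _ (hy₀.1 i) hi)
  | succ m ihm =>
    refine leftRank_le_veblenOpow_of_lower hC (m + 1) fun x w a ha hne hw hcount => ?_
    obtain ⟨y₀, hy₀, hmax⟩ := Set.exists_max_image _ (outerRank C w)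
      (finite_splittings hC.isWF n w) hne
    have hlt : outerRank C w y₀ < veblenOpow (m + 1) x :=
      outerRank_lt (isPrincipal_mixOp_veblenOpow _ x) (veblenOpow_pos _ x)
        fun i hi => hw _ (hy₀.1 i) hi
    obtain ⟨k, hk, hkw⟩ := exists_leftRank_bound hC.isWF hC.isClosed (veblenOpow_pos (m + 1) x)
      fun v hv hva => hw v hv (lt_of_le_of_lt hva ha.lt)
    have hk1 : k + 1 < veblenOpow (m + 1) x := isPrincipal_add_veblenOpow _ _ hk
      (Ordinal.one_lt_omega0.trans_le (omega0_le_veblenOpow _ _))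
    refine (ihm (outerRank C w y₀) (k + 1) w a ha (fun v hv hva => ?_) fun y hy =>
      ⟨Nat.lt_succ_iff.1 (hcount y hy), fun _ => hmax y hy⟩).trans_lt
      (veblenOpow_add_opow_lt_succ hk1 hlt)
    exact (hkw v hv hva).trans_lt ((Order.lt_add_one_iff.2 le_rfl).trans_le (le_veblenOpow _ _))

theorem eqCount_le_of_mem_splittings {m : ℕ} {C : Set ℝ} {z : ℝ} {y : Fin (m + 2) → ℝ}
    (hy : y ∈ splittings C (m + 2) z) : eqCount z y ≤ m + 1 := by
  classical
  by_contra! h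
  have hcard : (Finset.univ.filter fun i => y i = z) = Finset.univ := by
    refine Finset.eq_univ_of_card _ (le_antisymm (Finset.card_le_univ _) ?_)
    rw [Fintype.card_fin]
    exact h
  have hall : ∀ i, y i = z := fun i => by
    have := Finset.ext_iff.1 hcard i
    simpa using this
  have := hy.2.2
  simp [hall] at this

theorem eq_sub_one_of_eqCount {m : ℕ} {C : Set ℝ} {z : ℝ} {y : Fin (m + 2) → ℝ}
    (hy : y ∈ splittings C (m + 2) z) (hc : eqCount z y = m + 1) {i : Fin (m + 2)} (hi : y i < z) :
    y i = z - 1 := by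
  classical
  have hcard : (Finset.univ.filter fun j => ¬ y j = z).card = 1 := by
    have := Finset.card_filter_add_card_filter_not (s := Finset.univ) (fun j => y j = z)
    rw [eqCount] at hc
    simp only [Finset.card_univ, Fintype.card_fin] at this
    omega
  obtain ⟨j, hj⟩ := Finset.card_eq_one.1 hcard
  have hmem : ∀ k, ¬ y k = z ↔ k = j := fun k => by
    have := Finset.ext_iff.1 hj k
    simpa using this
  have hij : i = j := (hmem i).1 hi.ne
  have hsum := hy.2.2
  rw [Finset.sum_eq_single i (fun k _ hk => ?_) (fun h => absurd (Finset.mem_univ i) h)] at hsum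
  · linarith
  · have : y k = z := by
      by_contra h
      exact hk (((hmem k).1 h).trans hij.symm)
    rw [this, sub_self]

open Ordinal in
theorem exists_leftRank_lt_veblen {m : ℕ} {C : Set ℝ} (hC : IsClosedFusionSet (m + 2) C) (N : ℕ) :
    ∃ B < veblen (m + 1 : ℕ) 0, ∀ z ∈ C, z ≤ N → leftRank C z < B := by
  have hprin : IsPrincipal (· + ·) (veblen (m + 1 : ℕ) (0 : Ordinal.{0})) := by
    obtain ⟨c, hc⟩ := veblen_mem_range_opow ((m + 1 : ℕ) : Ordinal.{0}) 0
    simp only at hc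
    rw [← hc]
    exact isPrincipal_add_omega0_opow c
  have hone : 1 < veblen (m + 1 : ℕ) (0 : Ordinal.{0}) := by
    simpa using omega0_opow_lt_veblen_succ (m := m) (a := 0) (b := 0) veblen_pos
  induction N with
  | zero =>
    refine ⟨1, hone, fun z hz hz0 => lt_of_le_of_lt (b := 0) ?_ zero_lt_one⟩
    refine leftRank_le hC.isWF (sub_one_lt z) fun w hw _ hwz => absurd (hC.nonneg w hw) ?_
    push_cast at hz0
    linarith
  | succ N ih =>
    obtain ⟨B, hB, hBz⟩ := ih
    set s := veblenOpow m B with hs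
    have hsT : s < veblen (m + 1 : ℕ) 0 := veblenOpow_lt_veblen_succ hB
    -- When m + 1 entries equal z, the other one is z - 1 ≤ N, of rank below B, so the outer rank is
    -- below s; the exponent s + 1 leaves room for ξ + ω ^ s.
    refine ⟨veblenOpow m (ω ^ (s + 1)), veblenOpow_lt_veblen_succ (omega0_opow_lt_veblen_succ
      (hprin hsT hone)), fun z hz => ?_⟩
    refine Set.WellFoundedOn.induction hC.isWF hz
      (P := fun z => z ≤ (N + 1 : ℕ) → leftRank C z < veblenOpow m (ω ^ (s + 1)))
      fun z hz ih hzN => ?_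
    obtain ⟨a, ha⟩ := hC.exists_isNear z
    obtain ⟨k, hk, hkw⟩ := exists_leftRank_bound hC.isWF hC.isClosed
      (veblenOpow_pos m (ω ^ (s + 1))) (b := a) fun w hw hwa =>
        ih w hw (hwa.trans_lt ha.lt) ((hwa.trans ha.lt.le).trans hzN)
    obtain ⟨ξ, hξ, hkξ⟩ := exists_lt_veblenOpow_add (m := m) (a := 0) (k := k) (s := s + 1)
      (by simp) (by simpa using hk)
    rw [zero_add] at hkξ
    refine (leftRank_le_veblenOpow hC m s ξ z a ha (fun w hw hwa => (hkw w hw hwa).trans_lt hkξ)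
      fun y hy => ⟨eqCount_le_of_mem_splittings hy, fun hc => ?_⟩).trans_lt
      ((isNormal_veblenOpow m).strictMono (isPrincipal_add_omega0_opow _ hξ
        ((isNormal_opow one_lt_omega0).strictMono (Order.lt_add_one_iff.2 le_rfl))))
    refine (outerRank_lt (isPrincipal_mixOp_veblenOpow m B) (veblenOpow_pos m B)
      fun i hi => ?_).le
    refine (hBz _ (hy.1 i) ?_).trans_le (le_veblenOpow m B)
    rw [eq_sub_one_of_eqCount hy hc hi]
    push_cast at hzN
    linarith

/-! ### From left rank to order type -/

theorem Set.IsWF.wellFounded_mem_lt {C : Set ℝ} (hC : C.IsWF) :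
    WellFounded fun w z : ℝ => w ∈ C ∧ w < z := by
  refine ⟨fun z => ⟨z, fun w hw => ?_⟩⟩
  exact Set.WellFoundedOn.induction hC hw.1 fun y _ ih => ⟨y, fun v hv => ih v hv.1 hv.2⟩

/-- The order type of the part of the well-ordered set `C` below `z`. -/
noncomputable def initRank {C : Set ℝ} (hC : C.IsWF) (z : ℝ) : Ordinal.{0} :=
  @IsWellFounded.rank ℝ (fun w z => w ∈ C ∧ w < z) ⟨hC.wellFounded_mem_lt⟩ z

section

variable {C : Set ℝ} (hC : C.IsWF)

theorem initRank_lt {w z : ℝ} (hw : w ∈ C) (hwz : w < z) : initRank hC w < initRank hC z :=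
  @IsWellFounded.rank_lt_of_rel ℝ w z (fun w z => w ∈ C ∧ w < z) ⟨hC.wellFounded_mem_lt⟩ ⟨hw, hwz⟩

theorem initRank_le {z : ℝ} {g : Ordinal.{0}} (h : ∀ w ∈ C, w < z → initRank hC w < g) :
    initRank hC z ≤ g := by
  rw [initRank, @IsWellFounded.rank_eq ℝ (fun w z => w ∈ C ∧ w < z) ⟨hC.wellFounded_mem_lt⟩ z]
  exact Ordinal.iSup_le fun w => Order.succ_le_of_lt (h w.1 w.2.1 w.2.2)

theorem exists_le_initRank {z : ℝ} {g : Ordinal.{0}} (h : g < initRank hC z) :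
    ∃ w ∈ C, w < z ∧ g ≤ initRank hC w := by
  by_contra! hcon
  exact absurd (initRank_le hC hcon) (not_le.2 h)

theorem initRank_mono : Monotone (initRank hC) := fun _ _ h =>
  initRank_le hC fun _ hw hwz => initRank_lt hC hw (hwz.trans_le h)

-- A point w in between is a limit of C, reached from a nearby c by adding at most a smaller power
-- of ω, or has a greatest predecessor above a, or none. Each step stays below ω ^ g by additive
-- principality.
open Ordinal in
theorem initRank_le_add_opow (hcl : IsClosed C) (g : Ordinal.{0}) : ∀ z a : ℝ, a < z →
    (∀ w ∈ C, a < w → w < z → leftRank C w < g) →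
    initRank hC z ≤ initRank hC a + ω ^ g := by
  induction g using WellFoundedLT.induction with
  | ind g ih =>
    intro z a haz hg
    refine initRank_le hC fun w hw hwz => ?_
    rcases le_or_gt w a with hwa | hwa
    · exact (initRank_mono hC hwa).trans_lt (lt_add_of_pos_right _ (opow_pos _ omega0_pos))
    revert hwz hwa
    refine Set.WellFoundedOn.induction hC hw (P := fun w => w < z → a < w →
      initRank hC w < initRank hC a + ω ^ g) fun w hw ihw hwz haw => ?_
    have hg0 : 0 < g := pos_of_gt (hg w hw haw hwz)
    have h1 : (1 : Ordinal) < ω ^ g := one_lt_opow.2 ⟨one_lt_omega0, hg0.ne'⟩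
    have hadd : ∀ x d : Ordinal.{0}, x < initRank hC a + ω ^ g → d < ω ^ g →
        x + d < initRank hC a + ω ^ g := by
      intro x d hx hd
      rcases le_or_gt (initRank hC a) x with h | h
      · have hx' : x - initRank hC a < ω ^ g := by
          rwa [← add_lt_add_iff_left (initRank hC a), Ordinal.add_sub_cancel_of_le h]
        rw [← Ordinal.add_sub_cancel_of_le h, add_assoc]
        gcongr
        exact isPrincipal_add_omega0_opow g hx' hd
      · exact (add_le_add_left h.le d).trans_lt (by gcongr)
    by_cases hne : (C ∩ Set.Ioo a w).Nonempty
    · have hbd : BddAbove (C ∩ Set.Ioo a w) := bddAbove_Ioo.mono Set.inter_subset_right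
      obtain ⟨c₀, hc₀⟩ := hne
      have has : a < sSup (C ∩ Set.Ioo a w) := hc₀.2.1.trans_le (le_csSup hbd hc₀)
      have hsw : sSup (C ∩ Set.Ioo a w) ≤ w := csSup_le ⟨c₀, hc₀⟩ fun c hc => hc.2.2.le
      have hsC : sSup (C ∩ Set.Ioo a w) ∈ C :=
        closure_minimal Set.inter_subset_left hcl (csSup_mem_closure ⟨c₀, hc₀⟩ hbd)
      rcases hsw.eq_or_lt with heq | hlt
      · obtain ⟨b, hbw, hb⟩ := exists_leftRank_lt hC w
        obtain ⟨c, hc, hbc⟩ := exists_lt_of_lt_csSup ⟨c₀, hc₀⟩ (hbw.trans_eq heq.symm)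
        refine (ih _ (hg w hw haw hwz) w c hc.2.2 fun v hv hcv hvw =>
          hb v hv (hbc.trans hcv) hvw).trans_lt (hadd _ _ (ihw c hc.1 hc.2.2 (hc.2.2.trans hwz)
            hc.2.1) ((isNormal_opow one_lt_omega0).strictMono (hg w hw haw hwz)))
      · refine (initRank_le hC (g := initRank hC (sSup (C ∩ Set.Ioo a w)) + 1)
          fun v hv hvw => Order.lt_add_one_iff.2 (initRank_mono hC ?_)).trans_lt
          (hadd _ _ (ihw _ hsC hlt (hlt.trans hwz) has) h1)
        rcases le_or_gt v a with h | h
        · exact h.trans has.le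
        · exact le_csSup hbd ⟨hv, h, hvw⟩
    · refine (initRank_le hC (g := initRank hC a + 1) fun v hv hvw =>
        Order.lt_add_one_iff.2 (initRank_mono hC ?_)).trans_lt (by gcongr)
      by_contra! h
      exact hne ⟨v, hv, h, hvw⟩

end

open Ordinal in
theorem initRank_lt_veblen {m : ℕ} {C : Set ℝ} (hC : IsClosedFusionSet (m + 2) C) (z : ℝ) :
    initRank hC.isWF z < veblen (m + 1 : ℕ) 0 := by
  obtain ⟨N, hN⟩ := exists_nat_ge z
  obtain ⟨B, hB, hBz⟩ := exists_leftRank_lt_veblen hC N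
  have h0 : initRank hC.isWF (min z 0 - 1) ≤ 0 := initRank_le _ fun w hw hwz => by
    linarith [hC.nonneg w hw, min_le_right z 0]
  have h := initRank_le_add_opow hC.isWF hC.isClosed B z (min z 0 - 1)
    (by linarith [min_le_left z 0]) fun w hw _ hwz => hBz w hw (hwz.le.trans hN)
  rw [nonpos_iff_eq_zero.1 h0, zero_add] at h
  exact h.trans_lt (omega0_opow_lt_veblen_succ hB)

theorem Set.IsWF.isWellOrder {S : Set ℝ} (hS : S.IsWF) : IsWellOrder S (· < ·) where
  wf := ⟨fun x => Set.WellFoundedOn.induction (P := fun x => ∀ h : x ∈ S, Acc (· < ·) (⟨x, h⟩ : S))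
      hS x.2 (fun _ _ ih _ => ⟨_, fun z hz => ih z z.2 hz _⟩) x.2⟩

theorem type_le_of_initRank_lt {S C : Set ℝ} (hC : C.IsWF) (hSC : S ⊆ C)
    (hS : IsWellOrder S (· < ·)) {o : Ordinal.{0}} (h : ∀ z ∈ S, initRank hC z < o) :
    @Ordinal.type S (· < ·) hS ≤ o := by
  by_contra! hlt
  have hle : ∀ x : S, @Ordinal.typein S (· < ·) hS x ≤ initRank hC x := by
    intro x
    induction x using hS.wf.induction with
    | _ x ih =>
      by_contra! hx
      obtain ⟨y, hy⟩ := @Ordinal.typein_surj S (· < ·) hS _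
        (hx.trans (@Ordinal.typein_lt_type S (· < ·) hS x))
      have hyx : y < x := (@Ordinal.typein_lt_typein S (· < ·) hS _ _).1 (hy ▸ hx)
      exact absurd (initRank_lt hC (hSC y.2) hyx) (not_lt.2 (hy ▸ ih y hyx))
  obtain ⟨x, hx⟩ := @Ordinal.typein_surj S (· < ·) hS _ hlt
  exact absurd (h x x.2) (not_lt.2 (hx ▸ hle x))

/-! ### The algorithm: affine behaviour, fusibility of outputs -/

theorem MRuns.unique {n : ℕ} {x y : ℝ} (h : MRuns n x y) : ∀ {y'}, MRuns n x y' → y = y' := by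
  induction h with
  | neg x hx =>
    intro y' h'
    cases h' with
    | neg _ _ => rfl
    | nonneg _ h0 => exact absurd h0 (not_le.2 hx)
  | nonneg x hx t h0 ht ih =>
    intro y' h'
    cases h' with
    | neg _ h1 => exact absurd hx (not_le.2 h1)
    | nonneg _ _ t' h0' ht' =>
      have : ∀ i ≤ n, t i = t' i := by
        intro i
        induction i with
        | zero => intro _; rw [h0, h0']
        | succ i hi =>
          intro hin
          have h := ht' i hin
          rw [← hi (by omega)] at h
          exact ih i hin h
      rw [this n le_rfl]

theorem MRuns.eq_neg {n : ℕ} {x y : ℝ} (h : MRuns n x y) (hx : x < 0) : y = -x :=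
  h.unique (MRuns.neg x hx)

/-- A record of the successive values `t_0, …, t_n` in the computation of `M_n(x)` for `x ≥ 0`,
their monotonicity, and the values in the computation of `M_n` slightly to the right of `x`. -/
structure MTrace (n : ℕ) (x y : ℝ) (t : ℕ → ℝ) : Prop where
  zero : t 0 = 1
  call : ∀ i < n, MRuns n (x - t i) (t (i + 1))
  eq : y = t n / n
  anti : ∀ i < n, t (i + 1) ≤ t i
  pos : ∀ i ≤ n, 0 < t i
  shift : ∀ x', x ≤ x' → ∀ j < n, (j + 1) * (x' - x) < t (j + 1) →
    MRuns n (x' - (t j - j * (x' - x))) (t (j + 1) - (j + 1) * (x' - x))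

theorem MTrace.le {n : ℕ} {x y : ℝ} {t : ℕ → ℝ} (h : MTrace n x y t) {i j : ℕ} (hij : i ≤ j)
    (hj : j ≤ n) : t j ≤ t i := by
  induction j, hij using Nat.le_induction with
  | base => exact le_rfl
  | succ j _ ih => exact (h.anti j hj).trans (ih (by omega))

theorem MTrace.mul_le {n : ℕ} {x y : ℝ} {t : ℕ → ℝ} (h : MTrace n x y t) {i k : ℕ} (hi : i ≤ k)
    (hk : k ≤ n) (hn : 0 < n) : k * y ≤ t i := by
  have hn' : (0 : ℝ) < n := by exact_mod_cast hn
  have hkn : (k : ℝ) ≤ n := by exact_mod_cast hk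
  rw [h.eq]
  calc k * (t n / n) = (k / n) * t n := by ring
    _ ≤ 1 * t n := by
      have := h.pos n le_rfl
      gcongr
      rwa [div_le_one hn']
    _ = t n := one_mul _
    _ ≤ t i := h.le (hi.trans hk) le_rfl

/-- One induction on the run must carry everything: the decrease of the t_i at x uses the trace of
the inner call, and the affine behaviour of M_n uses that decrease. -/
theorem MRuns.tame {n : ℕ} (hn : 0 < n) {x y : ℝ} (h : MRuns n x y) :
    0 < y ∧ (∀ x', x ≤ x' → x' < x + y → MRuns n x' (x + y - x')) ∧
      (0 ≤ x → ∃ t, MTrace n x y t) := by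
  induction h with
  | neg x hx =>
    refine ⟨by linarith, fun x' _ hlt => ?_, fun h0 => absurd h0 (not_le.2 hx)⟩
    have := MRuns.neg (n := n) x' (by linarith)
    convert this using 1
    ring
  | nonneg x hx t h0 ht ih =>
    have hpos : ∀ i ≤ n, 0 < t i := by
      intro i hi
      cases i with
      | zero => rw [h0]; exact one_pos
      | succ i => exact (ih i hi).1
    have hshift : ∀ x', x ≤ x' → ∀ j < n, (j + 1) * (x' - x) < t (j + 1) →
        MRuns n (x' - (t j - j * (x' - x))) (t (j + 1) - (j + 1) * (x' - x)) := by
      intro x' hx' j hj hlt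
      have hnn : 0 ≤ (j + 1 : ℝ) * (x' - x) := mul_nonneg (by positivity) (by linarith)
      have := (ih j hj).2.1 (x' - (t j - j * (x' - x))) (by linarith) (by linarith)
      convert this using 1
      ring
    have hanti : ∀ i < n, t (i + 1) ≤ t i := by
      intro i hi
      rcases lt_or_ge (x - t i) 0 with hu | hu
      · have := (ht i hi).eq_neg hu
        linarith
      obtain ⟨s, hs⟩ := (ih i hi).2.2 hu
      rcases i.eq_zero_or_pos with rfl | hi0
      · have := hs.mul_le (i := 0) (k := 1) (by norm_num) hn hn
        rw [hs.zero] at this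
        rw [h0]
        simpa using this
      have hi0' : (0 : ℝ) < i := by exact_mod_cast hi0
      -- Here s is the trace at x - t i. If s i ≤ i * t i, then i * t (i + 1) ≤ s i suffices.
      -- Otherwise s shifts right by t i to the trace at x, so s i = (i + 1) * t i, and (i + 1) * t
      -- (i + 1) ≤ s i.
      rcases le_or_gt (s i) (i * t i) with hle | hlt
      · have h1 := hs.mul_le (i := i) (k := i) le_rfl hi.le hn
        exact le_of_mul_le_mul_left (h1.trans hle) hi0'
      · have heq : ∀ j ≤ i, t j = s j - j * t i := by
          intro j
          induction j with
          | zero => intro _; simp [h0, hs.zero]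
          | succ j hj =>
            intro hji
            have hcast : ((j + 1 : ℕ) : ℝ) ≤ i := by exact_mod_cast hji
            have hsi := hs.le hji hi.le
            have hti := hpos i hi.le
            have hm := hs.shift x (by linarith) j (by omega) (by
              push_cast at hcast
              have : (j + 1 : ℝ) * (x - (x - t i)) ≤ i * t i := by
                rw [sub_sub_cancel]; gcongr
              linarith)
            rw [sub_sub_cancel, ← hj (by omega)] at hm
            rw [(ht j (by omega)).unique hm]
            push_cast
            ring
        have h1 := heq i le_rfl
        have h2 := hs.mul_le (i := i) (k := i + 1) (by omega) hi hn
        push_cast at h2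
        have h3 : (i + 1 : ℝ) * t (i + 1) ≤ (i + 1) * t i := by linarith
        exact le_of_mul_le_mul_left h3 (by positivity)
    have htr : MTrace n x (t n / n) t := ⟨h0, ht, rfl, hanti, hpos, hshift⟩
    have hn' : (0 : ℝ) < n := by exact_mod_cast hn
    refine ⟨div_pos (hpos n le_rfl) hn', fun x' hx' hlt => ?_, fun _ => ⟨t, htr⟩⟩
    have := MRuns.nonneg x' (hx.trans hx') (fun j => t j - j * (x' - x)) (by simp [h0])
      fun j hj => by
        have h1 := htr.mul_le (i := j + 1) (k := j + 1) le_rfl hj hn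
        have h2 := hshift x' hx' j hj (lt_of_lt_of_le
          (by push_cast; exact mul_lt_mul_of_pos_left (by linarith) (by positivity)) h1)
        push_cast
        exact h2
    convert this using 1
    field_simp
    ring

theorem sum_fin_telescope {n : ℕ} (k : ℕ) (hk : k ≤ n) (x : ℝ) (t : ℕ → ℝ) :
    ∑ i : Fin n, (if (i : ℕ) < k then x - t i + t (i + 1) else 0) = k * x - t 0 + t k := by
  rw [Fin.sum_univ_eq_sum_range (fun i => if i < k then x - t i + t (i + 1) else 0) n,
    ← Finset.sum_filter]
  have : (Finset.range n).filter (· < k) = Finset.range k := by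
    ext i
    simp only [Finset.mem_filter, Finset.mem_range]
    omega
  rw [this]
  have h2 : ∀ i, x - t i + t (i + 1) = x + (t (i + 1) - t i) := fun i => by ring
  simp only [h2, Finset.sum_add_distrib, Finset.sum_range_sub, Finset.sum_const, Finset.card_range,
    nsmul_eq_mul]
  ring

/-- The value is the fusion of the (x - t_i) + t_{i+1}, whose sum telescopes; each is at most x
since t decreases. -/
theorem MRuns.add_mem_fusible {n : ℕ} (hn : 0 < n) {x y : ℝ} (h : MRuns n x y) :
    x + y ∈ fusible n := by
  have hn' : (n : ℝ) ≠ 0 := by exact_mod_cast hn.ne'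
  induction h with
  | neg x hx => exact Generated.base _ (by simp)
  | nonneg x hx t h0 ht ih =>
    have hg : fuseFun n (fun i : Fin n => x - t i + t (i + 1)) = x + t n / n := by
      have h1 := sum_fin_telescope n le_rfl x t
      simp only [Fin.is_lt, if_true] at h1
      rw [fuseFun, h1, h0]
      field_simp
      ring
    obtain ⟨hpos, -, htr⟩ := (MRuns.nonneg x hx t h0 ht).tame hn
    obtain ⟨s, hs⟩ := htr hx
    have hst : ∀ i ≤ n, s i = t i := by
      intro i
      induction i with
      | zero => intro _; rw [h0, hs.zero]
      | succ i hi =>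
        intro hin
        have h := hs.call i hin
        rw [hi (by omega)] at h
        exact h.unique (ht i hin)
    change Generated _ _ _
    rw [← hg]
    refine Generated.app _ (fun i => ih i i.2) fun i => ?_
    rw [hg]
    have := hs.anti i i.2
    rw [hst _ i.2, hst _ i.2.le] at this
    linarith

theorem isFusionSet_fusible {n : ℕ} (hn : 0 < n) : IsFusionSet n (fusible n) where
  nonneg z hz := by
    change Generated _ _ _ at hz
    induction hz with
    | base x hx => exact (Set.mem_singleton_iff.1 hx).ge
    | app x _ _ ih =>
      exact div_nonneg (add_nonneg (Finset.sum_nonneg fun i _ => ih i) zero_le_one) (by positivity)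
  split z hz h0 := by
    change Generated _ _ _ at hz
    cases hz with
    | base _ hx => exact absurd hx h0
    | app x hx hlt =>
      refine ⟨x, hx, hlt, ?_⟩
      have hn' : (n : ℝ) ≠ 0 := by exact_mod_cast hn.ne'
      rw [Finset.sum_sub_distrib, Finset.sum_const, Finset.card_univ, Fintype.card_fin,
        nsmul_eq_mul, fuseFun]
      field_simp
      ring

/-! ### Termination -/

theorem exists_failing_call_of_not_mRuns {n : ℕ} (x : ℝ) (hx : ¬ ∃ y, MRuns n x y) :
    ∃ i < n, ∃ t : ℕ → ℝ, t 0 = 1 ∧ (∀ j < i, MRuns n (x - t j) (t (j + 1))) ∧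
      ¬ ∃ y, MRuns n (x - t i) y := by
  have hx0 : 0 ≤ x := by
    by_contra! h
    exact hx ⟨_, MRuns.neg x h⟩
  by_contra! hcon
  have : ∀ k ≤ n, ∃ t : ℕ → ℝ, t 0 = 1 ∧ ∀ j < k, MRuns n (x - t j) (t (j + 1)) := by
    intro k
    induction k with
    | zero => exact fun _ => ⟨fun _ => 1, rfl, fun j hj => absurd hj (Nat.not_lt_zero j)⟩
    | succ k ih =>
      intro hk
      obtain ⟨t, h0, ht⟩ := ih (by omega)
      obtain ⟨y, hy⟩ := hcon k hk t h0 ht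
      refine ⟨Function.update t (k + 1) y, by simp [h0], fun j hj => ?_⟩
      rw [Function.update_of_ne (by omega)]
      rcases Nat.lt_succ_iff_lt_or_eq.1 hj with h | rfl
      · rw [Function.update_of_ne (by omega)]
        exact ht j h
      · rwa [Function.update_self]
  obtain ⟨t, h0, ht⟩ := this n le_rfl
  exact hx ⟨_, MRuns.nonneg x hx0 t h0 ht⟩

/-- Nontermination gives an infinite decreasing chain X of failing nonnegative inputs. The completed
calls produce fusible numbers Y summing to I X - 1 + t_I, and t_I is the next step of the chain.
Along a subsequence with I constant and Y nondecreasing this keeps t_I away from 0, although the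
chain converges. -/
theorem exists_mRuns {n : ℕ} (hn : 0 < n) (x : ℝ) : ∃ y, MRuns n x y := by
  by_contra hx
  choose! I hI t ht0 hcall hbad using fun (x : ℝ) (hx : ¬ ∃ y, MRuns n x y) =>
    exists_failing_call_of_not_mRuns x hx
  set X : ℕ → ℝ := fun k => (fun x => x - t x (I x))^[k] x with hX
  have hXs : ∀ k, X (k + 1) = X k - t (X k) (I (X k)) := fun k =>
    Function.iterate_succ_apply' _ _ _
  have hXbad : ∀ k, ¬ ∃ y, MRuns n (X k) y := by
    intro k
    induction k with
    | zero => exact hx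
    | succ k ih => rw [hXs]; exact hbad _ ih
  have hX0 : ∀ k, 0 ≤ X k := by
    intro k
    by_contra! h
    exact hXbad k ⟨_, MRuns.neg _ h⟩
  have htpos : ∀ k, 0 < t (X k) (I (X k)) := by
    intro k
    rcases hI' : I (X k) with _ | i
    · rw [ht0 _ (hXbad k)]; exact one_pos
    · exact ((hcall _ (hXbad k) i (by omega)).tame hn).1
  have hanti : StrictAnti X := strictAnti_nat_of_succ_lt fun k => by
    rw [hXs]; linarith [htpos k]
  have hbd : BddBelow (Set.range X) := ⟨0, by rintro _ ⟨k, rfl⟩; exact hX0 k⟩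
  have hlim := tendsto_atTop_ciInf hanti.antitone hbd
  set L := ⨅ k, X k
  have hL : ∀ k, L ≤ X k := ciInf_le hbd
  set Y : ℕ → Fin n → ℝ := fun k i =>
    if (i : ℕ) < I (X k) then X k - t (X k) i + t (X k) (i + 1) else 0 with hY
  have hYsum : ∀ k, ∑ i, Y k i = I (X k) * X k - 1 + t (X k) (I (X k)) := fun k => by
    rw [← ht0 _ (hXbad k)]
    exact sum_fin_telescope _ (hI _ (hXbad k)).le _ _
  have hYmem : ∀ k i, Y k i ∈ fusible n := by
    intro k i
    simp only [hY]
    split_ifs with h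
    · exact (hcall _ (hXbad k) i h).add_mem_fusible hn
    · exact Generated.base _ rfl
  -- Making both I and n - I nondecreasing forces I to be constant.
  have hpwo : ((Set.univ ×ˢ Set.univ) ×ˢ (Set.pi Set.univ fun _ : Fin n => fusible n) :
      Set ((ℕ × ℕ) × (Fin n → ℝ))).IsPWO :=
    ((Set.IsPWO.of_linearOrder _).prod (Set.IsPWO.of_linearOrder _)).prod
      (Set.IsPWO.pi fun _ => (isFusionSet_fusible hn).isWF.isPWO)
  obtain ⟨g, hg⟩ := hpwo.exists_monotone_subseq (f := fun k => ((I (X k), n - I (X k)), Y k))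
    (fun k => ⟨⟨trivial, trivial⟩, fun i _ => hYmem k i⟩)
  have hIconst : ∀ k, I (X (g k)) = I (X (g 0)) := fun k => by
    have h := hg (Nat.zero_le k)
    have h1 : I (X (g 0)) ≤ I (X (g k)) := h.1.1
    have h2 : n - I (X (g 0)) ≤ n - I (X (g k)) := h.1.2
    have := hI _ (hXbad (g k))
    omega
  set i := I (X (g 0)) with hi
  obtain ⟨N, hN⟩ := (hlim.eventually (gt_mem_nhds (show L < L + t (X (g 0)) i / (i + 1) from
    lt_add_of_pos_right _ (div_pos (htpos _) (by positivity))))).exists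
  have hgN : X (g N) ≤ X N := hanti.antitone g.strictMono.le_apply
  have hsum : ∑ j, Y (g 0) j ≤ ∑ j, Y (g N) j :=
    Finset.sum_le_sum fun j _ => (hg (Nat.zero_le N)).2 j
  rw [hYsum, hYsum, hIconst 0, hIconst N] at hsum
  have h1 := hXs (g N)
  rw [hIconst N] at h1
  have h2 : (i + 1 : ℝ) * (X (g N) - L) < t (X (g 0)) i := by
    rw [← lt_div_iff₀' (by positivity)]
    linarith
  have h3 : (i : ℝ) * L ≤ i * X (g 0) := mul_le_mul_of_nonneg_left (hL _) (by positivity)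
  linarith [hL (g N + 1)]

/-! ### Gaps and pieces -/

open Classical in
/-- The value `M_n(x)`. -/
noncomputable def mVal (n : ℕ) (x : ℝ) : ℝ := if h : ∃ y, MRuns n x y then h.choose else 0

theorem mRuns_mVal {n : ℕ} (hn : 0 < n) (x : ℝ) : MRuns n x (mVal n x) := by
  have h := exists_mRuns hn x
  rw [mVal, dif_pos h]
  exact h.choose_spec

/-- The successive values `t_0, t_1, …` in the computation of `M_n(x)`. -/
noncomputable def mIter (n : ℕ) (x : ℝ) : ℕ → ℝ
  | 0 => 1
  | i + 1 => mVal n (x - mIter n x i)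

/-- The element `x + M_n(x)` of `ℱ'_n`. -/
noncomputable def mNext (n : ℕ) (x : ℝ) : ℝ := x + mVal n x

theorem mTrace_mIter {n : ℕ} (hn : 0 < n) {x : ℝ} (hx : 0 ≤ x) :
    MTrace n x (mVal n x) (mIter n x) := by
  obtain ⟨t, ht⟩ := ((mRuns_mVal hn x).tame hn).2.2 hx
  have heq : ∀ i ≤ n, t i = mIter n x i := by
    intro i
    induction i with
    | zero => intro _; exact ht.zero
    | succ i ih =>
      intro hi
      have h := ht.call i hi
      rw [ih (by omega)] at h
      exact h.unique (mRuns_mVal hn _)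
  refine ⟨rfl, fun i _ => mRuns_mVal hn _, ?_, fun i hi => ?_, fun i hi => ?_,
    fun x' hx' j hj hlt => ?_⟩
  · rw [← heq n le_rfl]; exact ht.eq
  · rw [← heq (i + 1) hi, ← heq i hi.le]; exact ht.anti i hi
  · rw [← heq i hi]; exact ht.pos i hi
  · rw [← heq (j + 1) hj] at hlt ⊢
    rw [← heq j hj.le]
    exact ht.shift x' hx' j hj hlt

theorem mIter_shift {n : ℕ} (hn : 0 < n) {p x : ℝ} (hp : 0 ≤ p) (hpx : p ≤ x) {i : ℕ}
    (hi : i ≤ n) (hlt : i * (x - p) < mIter n p i) :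
    mIter n x i = mIter n p i - i * (x - p) := by
  have htr := mTrace_mIter hn hp
  have : ∀ j ≤ i, mIter n x j = mIter n p j - j * (x - p) := by
    intro j
    induction j with
    | zero => intro _; simp [mIter]
    | succ j ih =>
      intro hj
      have hcast : ((j + 1 : ℕ) : ℝ) ≤ i := by exact_mod_cast hj
      push_cast at hcast
      have h := htr.shift x hpx j (by omega) (by
        have h1 := htr.le hj hi
        have h2 : (j + 1 : ℝ) * (x - p) ≤ i * (x - p) :=
          mul_le_mul_of_nonneg_right hcast (by linarith)
        linarith)
      rw [← ih (by omega)] at h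
      push_cast
      exact (mRuns_mVal hn _).unique h
  exact this i le_rfl

theorem lt_mNext {n : ℕ} (hn : 0 < n) (x : ℝ) : x < mNext n x :=
  lt_add_of_pos_right _ ((mRuns_mVal hn x).tame hn).1

theorem mNext_eq {n : ℕ} (hn : 0 < n) {u x : ℝ} (hux : u ≤ x) (hx : x < mNext n u) :
    mNext n x = mNext n u := by
  have h := ((mRuns_mVal hn u).tame hn).2.1 x hux hx
  rw [mNext, (mRuns_mVal hn x).unique h, mNext]
  ring

theorem mNext_mono {n : ℕ} (hn : 0 < n) : Monotone (mNext n) := by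
  intro u x hux
  rcases lt_or_ge x (mNext n u) with h | h
  · exact (mNext_eq hn hux h).ge
  · exact h.trans (lt_mNext hn x).le

theorem mNext_of_neg {n : ℕ} (hn : 0 < n) {x : ℝ} (hx : x < 0) : mNext n x = 0 := by
  rw [mNext, (mRuns_mVal hn x).eq_neg hx, add_neg_cancel]

theorem mNext_nonneg {n : ℕ} (hn : 0 < n) (x : ℝ) : 0 ≤ mNext n x := by
  rcases lt_or_ge x 0 with h | h
  · exact (mNext_of_neg hn h).ge
  · exact h.trans (lt_mNext hn x).le

/-- The set of reals that are not interior to a gap of `ℱ'_n`. -/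
def gapEnds (n : ℕ) : Set ℝ := {z | 0 ≤ z ∧ ∀ u < z, mNext n u ≤ z}

theorem mNext_mem_gapEnds {n : ℕ} (hn : 0 < n) (x : ℝ) : mNext n x ∈ gapEnds n := by
  refine ⟨mNext_nonneg hn x, fun u hu => ?_⟩
  rcases le_total u x with h | h
  · exact mNext_mono hn h
  · exact (mNext_eq hn h hu).le

/-- A gap separates successive terms of a descending sequence, so their `mNext` values would descend
strictly in `fusible n`. -/
theorem isWF_gapEnds {n : ℕ} (hn : 0 < n) : (gapEnds n).IsWF := by
  rw [Set.isWF_iff_no_descending_seq]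
  intro f hf hS
  refine Set.isWF_iff_no_descending_seq.1 (isFusionSet_fusible hn).isWF (fun k => mNext n (f k))
    (strictAnti_nat_of_succ_lt fun k => ?_) fun k => (mRuns_mVal hn _).add_mem_fusible hn
  exact ((hS k).2 _ (hf k.lt_succ_self)).trans_lt (lt_mNext hn _)

/-- The reals that are not interior to a piece on which the `i`-th intermediate value of `M_n` is
affine. -/
def levelEnds (n i : ℕ) : Set ℝ := {z | 0 ≤ z ∧ ∀ u, 0 ≤ u → u < z → mIter n u i ≤ i * (z - u)}

theorem levelEnds_subset_succ {n i : ℕ} (hi : i < n) : levelEnds n i ⊆ levelEnds n (i + 1) := by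
  intro z hz
  refine ⟨hz.1, fun u hu huz => ?_⟩
  have h1 := (mTrace_mIter (by omega) hu).anti i hi
  have h2 := hz.2 u hu huz
  push_cast
  linarith

theorem levelEnds_subset_gapEnds {n : ℕ} (hn : 0 < n) {i : ℕ} (hi : i ≤ n) :
    levelEnds n i ⊆ gapEnds n := by
  induction hi using Nat.decreasingInduction with
  | of_succ i hi ih => exact (levelEnds_subset_succ hi).trans ih
  | self =>
    intro z hz
    refine ⟨hz.1, fun u huz => ?_⟩
    rcases lt_or_ge u 0 with hu | hu
    · rw [mNext_of_neg hn hu]; exact hz.1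
    · have hn' : (0 : ℝ) < n := by exact_mod_cast hn
      have h1 := hz.2 u hu huz
      have h2 : mVal n u = mIter n u n / n := (mTrace_mIter hn hu).eq
      rw [mNext, h2]
      have : mIter n u n / n ≤ z - u := by rwa [div_le_iff₀' hn']
      linarith

/-! ### Self-similarity of the pieces -/

/-- The affine map that carries the gap structure of `ℱ'_n` to the pieces of level `i + 1` inside
the piece of level `i` starting from `p`. -/
noncomputable def pieceMap (n i : ℕ) (p w : ℝ) : ℝ := p + (w - (p - mIter n p i)) / (i + 1)

/-- The domain of `pieceMap`. -/
def pieceDom (n i : ℕ) (p : ℝ) : Set ℝ :=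
  {w | p - mIter n p i ≤ w ∧ i * (w - (p - mIter n p i)) < (i + 1) * mIter n p i}

section

variable {n i : ℕ} {p : ℝ}

theorem pieceMap_strictMono : StrictMono (pieceMap n i p) := by
  intro a b h
  simp only [pieceMap]
  gcongr

theorem pieceMap_start : pieceMap n i p (p - mIter n p i) = p := by simp [pieceMap]

theorem exists_pieceMap_eq (a : ℝ) : ∃ v, pieceMap n i p v = a :=
  ⟨p - mIter n p i + (i + 1) * (a - p), by simp only [pieceMap]; field_simp; ring⟩

theorem pieceDom_of_le {v w : ℝ} (hw : w ∈ pieceDom n i p) (hvw : v ≤ w)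
    (hv : p - mIter n p i ≤ v) : v ∈ pieceDom n i p :=
  ⟨hv, lt_of_le_of_lt (mul_le_mul_of_nonneg_left (by linarith) (by positivity)) hw.2⟩

/-- For x = `pieceMap n i p w` the affine formula for t_i gives x - t_i(x) = w, so the next value is
M_n(w). -/
theorem mIter_pieceMap (hn : 0 < n) (hi : i ≤ n) (hp : 0 ≤ p) {w : ℝ}
    (hw : w ∈ pieceDom n i p) : mIter n (pieceMap n i p w) (i + 1) = mVal n w := by
  have h0 : 0 ≤ w - (p - mIter n p i) := by linarith [hw.1]
  have hi' : (0 : ℝ) < i + 1 := by positivity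
  have h1 : p ≤ pieceMap n i p w := by
    simp only [pieceMap]
    linarith [div_nonneg h0 hi'.le]
  have h2 : (i : ℝ) * (pieceMap n i p w - p) < mIter n p i := by
    simp only [pieceMap, add_sub_cancel_left]
    rw [← mul_div_assoc, div_lt_iff₀' hi']
    exact hw.2
  rw [mIter, mIter_shift hn hp h1 hi h2]
  congr 1
  simp only [pieceMap]
  field_simp
  ring

theorem pieceMap_mNext (hn : 0 < n) (hi : i ≤ n) (hp : 0 ≤ p) {w : ℝ}
    (hw : w ∈ pieceDom n i p) : pieceMap n i p (mNext n w) =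
      pieceMap n i p w + mIter n (pieceMap n i p w) (i + 1) / (i + 1 : ℕ) := by
  rw [mIter_pieceMap hn hi hp hw]
  simp only [pieceMap, mNext]
  push_cast
  ring

theorem pieceMap_mem_levelEnds (hn : 0 < n) (hi : i < n) (hp : p ∈ levelEnds n i) {w : ℝ}
    (hwC : w ∈ gapEnds n ∨ w = p - mIter n p i) (hw : w ∈ pieceDom n i p) :
    pieceMap n i p w ∈ levelEnds n (i + 1) := by
  have hpw : p ≤ pieceMap n i p w := by
    conv_lhs => rw [← pieceMap_start (n := n) (i := i) (p := p)]
    exact pieceMap_strictMono.monotone hw.1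
  refine ⟨hp.1.trans hpw, fun u hu huw => ?_⟩
  rcases lt_or_ge u p with h | h
  · have h1 := (mTrace_mIter (by omega) hu).anti i hi
    have h2 := hp.2 u hu h
    have h3 : (i : ℝ) * (p - u) ≤ i * (pieceMap n i p w - u) :=
      mul_le_mul_of_nonneg_left (by linarith) (by positivity)
    push_cast
    linarith
  · obtain ⟨v, rfl⟩ := exists_pieceMap_eq (n := n) (i := i) (p := p) u
    have hvw := pieceMap_strictMono.lt_iff_lt.1 huw
    have hv : p - mIter n p i ≤ v := by
      rw [← pieceMap_strictMono.le_iff_le (f := pieceMap n i p), pieceMap_start]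
      exact h
    rcases hwC with hwC | rfl
    · rw [mIter_pieceMap hn hi.le hp.1 (pieceDom_of_le hw hvw.le hv)]
      have h1 := hwC.2 v hvw
      rw [mNext] at h1
      have h2 : ((i + 1 : ℕ) : ℝ) * (pieceMap n i p w - pieceMap n i p v) = w - v := by
        simp only [pieceMap]
        push_cast
        field_simp
        ring
      rw [h2]
      linarith
    · exact absurd hvw (not_lt.2 hv)

theorem mIter_pos (hn : 0 < n) (hi : i ≤ n) (hp : 0 ≤ p) : 0 < mIter n p i :=
  (mTrace_mIter hn hp).pos i hi

theorem start_mem_pieceDom (hn : 0 < n) (hi : i ≤ n) (hp : 0 ≤ p) :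
    p - mIter n p i ∈ pieceDom n i p :=
  ⟨le_rfl, by have := mIter_pos hn hi hp; rw [sub_self, mul_zero]; positivity⟩

theorem self_mem_pieceDom (hn : 0 < n) (hi : i ≤ n) (hp : 0 ≤ p) : p ∈ pieceDom n i p := by
  have := mIter_pos hn hi hp
  refine ⟨by linarith, ?_⟩
  rw [sub_sub_cancel]
  linarith

theorem pieceMap_mem_pieceDom {w : ℝ} (hn : 0 < n) (hi : i ≤ n) (hp : 0 ≤ p)
    (hw : w ∈ pieceDom n i p) : pieceMap n i p w ∈ pieceDom n i p ∧ w < pieceMap n i p w := by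
  have hT := mIter_pos hn hi hp
  have hi' : (0 : ℝ) < i + 1 := by positivity
  have h0 : 0 ≤ w - (p - mIter n p i) := by linarith [hw.1]
  have h1 : 0 ≤ (w - (p - mIter n p i)) / (i + 1) := div_nonneg h0 hi'.le
  have h2 : (i : ℝ) * ((w - (p - mIter n p i)) / (i + 1)) < mIter n p i := by
    rw [← mul_div_assoc, div_lt_iff₀' hi']
    exact hw.2
  have h3 : (w - (p - mIter n p i)) =
      (i + 1) * ((w - (p - mIter n p i)) / (i + 1)) := by field_simp
  simp only [pieceDom, Set.mem_ofPred_eq, pieceMap]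
  refine ⟨⟨by linarith, ?_⟩, by linarith⟩
  have : p + (w - (p - mIter n p i)) / (i + 1) - (p - mIter n p i) =
    mIter n p i + (w - (p - mIter n p i)) / (i + 1) := by ring
  rw [this]
  linarith

/-- The iterates of `p` under `pieceMap`. -/
noncomputable def pieceSeq (n i : ℕ) (p : ℝ) (k : ℕ) : ℝ := (pieceMap n i p)^[k] p

theorem pieceSeq_succ (k : ℕ) : pieceSeq n i p (k + 1) = pieceMap n i p (pieceSeq n i p k) :=
  Function.iterate_succ_apply' _ _ _

theorem pieceSeq_mem (hn : 0 < n) (hi : i < n) (hp : p ∈ levelEnds n i) (k : ℕ) :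
    pieceSeq n i p k ∈ pieceDom n i p ∧ pieceSeq n i p k ∈ gapEnds n := by
  induction k with
  | zero => exact ⟨self_mem_pieceDom hn hi.le hp.1, levelEnds_subset_gapEnds hn hi.le hp⟩
  | succ k ih =>
    rw [pieceSeq_succ]
    exact ⟨(pieceMap_mem_pieceDom hn hi.le hp.1 ih.1).1,
      levelEnds_subset_gapEnds hn hi (pieceMap_mem_levelEnds hn hi hp (Or.inl ih.2) ih.1)⟩

theorem pieceSeq_strictMono (hn : 0 < n) (hi : i < n) (hp : p ∈ levelEnds n i) :
    StrictMono (pieceSeq n i p) :=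
  strictMono_nat_of_lt_succ fun k => by
    rw [pieceSeq_succ]
    exact (pieceMap_mem_pieceDom hn hi.le hp.1 (pieceSeq_mem hn hi hp k).1).2

theorem pieceSeq_lt (hn : 0 < n) (hi : i < n) (hi0 : 0 < i) (hp : p ∈ levelEnds n i) (k : ℕ) :
    pieceSeq n i p k < p + mIter n p i / i := by
  have h := (pieceSeq_mem hn hi hp k).1.2
  have hi' : (0 : ℝ) < i := by exact_mod_cast hi0
  have h1 : pieceSeq n i p k - (p - mIter n p i) < (i + 1) * mIter n p i / i := by
    rwa [lt_div_iff₀' hi']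
  have h2 : (i + 1) * mIter n p i / i = mIter n p i + mIter n p i / i := by field_simp
  linarith

/-- The end p + t_i(p) / i of the piece is the fixed point of `pieceMap`, a contraction of ratio 1 /
(i + 1). -/
theorem exists_lt_pieceSeq (hi0 : 0 < i) {a : ℝ}
    (ha : a < p + mIter n p i / i) : ∃ k, a < pieceSeq n i p k := by
  have hi' : (0 : ℝ) < i := by exact_mod_cast hi0
  have hform : ∀ k, p + mIter n p i / i - pieceSeq n i p k = mIter n p i / i * (1 / (i + 1)) ^ k := by
    intro k
    induction k with
    | zero => simp [pieceSeq]
    | succ k ih =>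
      rw [pow_succ, ← mul_assoc, ← ih, pieceSeq_succ, pieceMap]
      field_simp
      ring
  have hlim : Filter.Tendsto (fun k : ℕ => mIter n p i / i * (1 / (i + 1 : ℝ)) ^ k) Filter.atTop
      (nhds (mIter n p i / i * 0)) :=
    (tendsto_pow_atTop_nhds_zero_of_lt_one (by positivity)
      (by rw [div_lt_one (by positivity)]; linarith)).const_mul _
  rw [mul_zero] at hlim
  obtain ⟨k, hk⟩ := (hlim.eventually (gt_mem_nhds (sub_pos.2 ha))).exists
  exact ⟨k, by linarith [hform k]⟩

end

/-! ### Tails and the lower bound -/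

theorem Ordinal.add_le_of_forall_add_lt {a b c : Ordinal.{0}} (hac : a ≤ c)
    (h : ∀ d < b, a + d < c) : a + b ≤ c := by
  by_contra! hlt
  have h1 : c - a < b := by rwa [← add_lt_add_iff_left a, Ordinal.add_sub_cancel_of_le hac]
  exact absurd (h _ h1) (by rw [Ordinal.add_sub_cancel_of_le hac]; exact lt_irrefl c)

/-- Every left neighbourhood of `z` contains a part of `C` of order type at least `b`. -/
def HasTails {C : Set ℝ} (hC : C.IsWF) (z : ℝ) (b : Ordinal.{0}) : Prop :=
  ∀ a < z, initRank hC a + b ≤ initRank hC z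

theorem HasTails.mono {C : Set ℝ} {hC : C.IsWF} {z : ℝ} {b b' : Ordinal.{0}}
    (h : HasTails hC z b) (hb : b' ≤ b) : HasTails hC z b' := fun a ha =>
  (add_le_add_right hb _).trans (h a ha)

section

variable {n i : ℕ} {p : ℝ}

/-- `pieceMap` sends gap ends in its domain to gap ends, strictly increasingly, so order types
between points cannot shrink. -/
theorem pieceMap_initRank (hn : 0 < n) (hi : i < n) (hp : p ∈ levelEnds n i) {a : ℝ}
    (ha : p - mIter n p i ≤ a) {w : ℝ} (hw : w ∈ pieceDom n i p) (haw : a ≤ w) {b : Ordinal.{0}}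
    (hb : initRank (isWF_gapEnds hn) a + b ≤ initRank (isWF_gapEnds hn) w) :
    initRank (isWF_gapEnds hn) (pieceMap n i p a) + b ≤
      initRank (isWF_gapEnds hn) (pieceMap n i p w) := by
  revert b hw haw
  induction w using (isWF_gapEnds hn).wellFounded_mem_lt.induction with
  | _ w ih =>
    intro hw haw b hb
    refine Ordinal.add_le_of_forall_add_lt (initRank_mono _ (pieceMap_strictMono.monotone haw))
      fun d hd => ?_
    obtain ⟨v, hvC, hvw, hv⟩ := exists_le_initRank (isWF_gapEnds hn)
      (lt_of_lt_of_le (by gcongr : initRank (isWF_gapEnds hn) a + d < _) hb)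
    have hav : a ≤ v := by
      by_contra! h
      exact absurd (initRank_lt (isWF_gapEnds hn) hvC h) (not_lt.2 (le_self_add.trans hv))
    have hvD := pieceDom_of_le hw hvw.le (ha.trans hav)
    exact (ih v ⟨hvC, hvw⟩ hvD hav hv).trans_lt (initRank_lt _ (levelEnds_subset_gapEnds hn hi
      (pieceMap_mem_levelEnds hn hi hp (Or.inl hvC) hvD)) (pieceMap_strictMono hvw))

theorem HasTails.pieceMap (hn : 0 < n) (hi : i < n) (hp : p ∈ levelEnds n i) {w : ℝ}
    (hw : w ∈ pieceDom n i p) (hpw : p ≤ w) {b : Ordinal.{0}}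
    (hb : HasTails (isWF_gapEnds hn) w b) :
    HasTails (isWF_gapEnds hn) (pieceMap n i p w) b := by
  intro a ha
  have hT := mIter_pos hn hi.le hp.1
  rcases lt_or_ge a p with h | h
  · have h1 := pieceMap_initRank hn hi hp le_rfl hw (by linarith) (hb (p - mIter n p i)
      (by linarith))
    rw [pieceMap_start] at h1
    exact (add_le_add_left (initRank_mono _ h.le) b).trans h1
  · obtain ⟨v, rfl⟩ := exists_pieceMap_eq (n := n) (i := i) (p := p) a
    have hvw := pieceMap_strictMono.lt_iff_lt.1 ha
    refine pieceMap_initRank hn hi hp ?_ hw hvw.le (hb v hvw)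
    rw [← pieceMap_strictMono.le_iff_le (f := _root_.pieceMap n i p), pieceMap_start]
    exact h

theorem HasTails.pieceSeq_mono (hn : 0 < n) (hi : i < n) (hp : p ∈ levelEnds n i) {k l : ℕ} (hkl : k ≤ l)
    {b : Ordinal.{0}} (hb : HasTails (isWF_gapEnds hn) (pieceSeq n i p k) b) :
    HasTails (isWF_gapEnds hn) (pieceSeq n i p l) b := by
  induction l, hkl using Nat.le_induction with
  | base => exact hb
  | succ l _ ih =>
    rw [pieceSeq_succ]
    exact ih.pieceMap hn hi hp (pieceSeq_mem hn hi hp l).1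
      ((pieceSeq_strictMono hn hi hp).monotone (Nat.zero_le l))

-- Infinitely many intervals between terms of `pieceSeq` accumulate at the end of the piece, each
-- containing type ω ^ ξ' for any given ξ' < ξ.
open Ordinal in
theorem hasTails_opow (hn : 0 < n) (hi : i < n) (hi0 : 0 < i) (hp : p ∈ levelEnds n i) {ξ : Ordinal.{0}}
    (h : ∀ ξ' < ξ, HasTails (isWF_gapEnds hn) p (ω ^ ξ')) :
    HasTails (isWF_gapEnds hn) (p + mIter n p i / i) (ω ^ ξ) := by
  intro a ha
  obtain ⟨k, hk⟩ := exists_lt_pieceSeq hi0 ha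
  have hlt : ∀ l, initRank (isWF_gapEnds hn) (pieceSeq n i p l) <
      initRank (isWF_gapEnds hn) (p + mIter n p i / i) := fun l =>
    initRank_lt _ (pieceSeq_mem hn hi hp l).2 (pieceSeq_lt hn hi hi0 hp l)
  have hak : initRank (isWF_gapEnds hn) a ≤ initRank (isWF_gapEnds hn) (pieceSeq n i p k) :=
    initRank_mono _ hk.le
  refine add_le_of_forall_add_lt (hak.trans (hlt k).le) fun d hd => ?_
  rcases eq_or_ne ξ 0 with rfl | hξ
  · rw [opow_zero, Order.lt_one_iff] at hd
    rw [hd, add_zero]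
    exact hak.trans_lt (hlt k)
  · obtain ⟨ξ', hξ', m, hm⟩ := (lt_omega0_opow hξ).1 hd
    have key : ∀ m : ℕ, initRank (isWF_gapEnds hn) a + ω ^ ξ' * m ≤
        initRank (isWF_gapEnds hn) (pieceSeq n i p (k + m)) := by
      intro m
      induction m with
      | zero => simpa using hak
      | succ m ihm =>
        have h1 : HasTails (isWF_gapEnds hn) (pieceSeq n i p (k + m + 1)) (ω ^ ξ') :=
          HasTails.pieceSeq_mono hn hi hp (Nat.zero_le _) (h ξ' hξ')
        have h2 := h1 _ (pieceSeq_strictMono hn hi hp (Nat.lt_succ_self (k + m)))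
        rw [Nat.cast_succ, mul_add_one, ← add_assoc]
        exact (add_le_add_left ihm _).trans h2
    refine lt_of_lt_of_le (b := initRank (isWF_gapEnds hn) a + ω ^ ξ' * m) (by gcongr)
      ((key m).trans (hlt _).le)

theorem exists_mNext_eq_of_gap (hn : 0 < n) {w a : ℝ} (haw : a < w)
    (ha : mNext n a = w) {c₀ : ℝ} (hc₀ : c₀ ∈ gapEnds n) (hc₀a : c₀ ≤ a) :
    ∃ c ∈ gapEnds n, c₀ ≤ c ∧ c < w ∧ mNext n c = w := by
  have hne : (gapEnds n ∩ Set.Iic a).Nonempty := ⟨c₀, hc₀, hc₀a⟩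
  have hbd : BddAbove (gapEnds n ∩ Set.Iic a) := bddAbove_Iic.mono Set.inter_subset_right
  have hca : sSup (gapEnds n ∩ Set.Iic a) ≤ a := csSup_le hne fun x hx => hx.2
  have hle : c₀ ≤ sSup (gapEnds n ∩ Set.Iic a) := le_csSup hbd ⟨hc₀, hc₀a⟩
  refine ⟨_, ⟨hc₀.1.trans hle, fun u hu => ?_⟩, hle, hca.trans_lt haw, ?_⟩
  · obtain ⟨x, hx, hux⟩ := exists_lt_of_lt_csSup hne hu
    exact (hx.1.2 u hux).trans (le_csSup hbd hx)
  · rw [← ha]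
    refine (mNext_eq hn hca ?_).symm
    by_contra! h
    exact absurd (le_csSup hbd ⟨mNext_mem_gapEnds hn _, h⟩) (not_le.2 (lt_mNext hn _))

-- By `hL`, each level-(i+1) piece advances the index of φ by one. The first, starting at p,
-- accounts for the 1 in ξ₀ + 1 + b; each gap after `mNext n (p - mIter n p i)` contributes one
-- more, and at limits the tails are inherited from the left.
open Ordinal in
theorem hasTails_pieceMap_of_initRank (hn : 0 < n) (hi : i + 1 ≤ n) (hp : p ∈ levelEnds n i)
    {φ : Ordinal.{0} → Ordinal.{0}} (hφ : Monotone φ)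
    (hL : ∀ q ∈ levelEnds n (i + 1), ∀ ξ, (∀ ξ' < ξ, HasTails (isWF_gapEnds hn) q (φ ξ')) →
      HasTails (isWF_gapEnds hn) (q + mIter n q (i + 1) / (i + 1 : ℕ)) (φ ξ))
    {ξ₀ : Ordinal.{0}} (h₀ : ∀ ξ' < ξ₀, HasTails (isWF_gapEnds hn) p (φ ξ')) {w : ℝ}
    (hwC : w ∈ gapEnds n) (hw : w ∈ pieceDom n i p) (hw₀ : mNext n (p - mIter n p i) ≤ w)
    {b : Ordinal.{0}} (hb : initRank (isWF_gapEnds hn) (mNext n (p - mIter n p i)) + b ≤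
      initRank (isWF_gapEnds hn) w) :
    ∀ ξ' < ξ₀ + 1 + b, HasTails (isWF_gapEnds hn) (pieceMap n i p w) (φ ξ') := by
  set o := initRank (isWF_gapEnds hn) with ho
  set w₀ := mNext n (p - mIter n p i) with hw₀def
  have hs0 : p - mIter n p i < w₀ := lt_mNext hn _
  have hw₀C : w₀ ∈ gapEnds n := mNext_mem_gapEnds hn _
  have hin : i < n := hi
  refine Set.WellFoundedOn.induction (isWF_gapEnds hn) hwC (P := fun w => w ∈ pieceDom n i p →
    w₀ ≤ w → ∀ {b : Ordinal.{0}}, o w₀ + b ≤ o w → ∀ ξ' < ξ₀ + 1 + b,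
      HasTails (isWF_gapEnds hn) (pieceMap n i p w) (φ ξ'))
    (fun w hwC ih hw hw₀ b hb ξ' hξ' => ?_) hw hw₀ hb
  rcases hw₀.eq_or_lt with heq | hlt
  · have hb0 : b = 0 := by
      rw [← heq] at hb
      by_contra h
      exact absurd hb (not_le.2 (lt_add_of_pos_right _ (pos_iff_ne_zero.2 h)))
    rw [hb0, add_zero, Order.lt_add_one_iff] at hξ'
    have h1 := hL p (levelEnds_subset_succ hin hp) ξ₀ h₀
    have h2 := pieceMap_mNext hn hin.le hp.1 (start_mem_pieceDom hn hin.le hp.1)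
    rw [pieceMap_start, ← hw₀def, heq] at h2
    rw [h2]
    exact h1.mono (hφ hξ')
  by_cases hsucc : ∃ c ∈ gapEnds n, w₀ ≤ c ∧ c < w ∧ mNext n c = w
  · obtain ⟨c, hcC, hwc, hcw, rfl⟩ := hsucc
    have hcD := pieceDom_of_le hw hcw.le (hs0.le.trans hwc)
    have hoc : o w₀ + (o c - o w₀) = o c :=
      Ordinal.add_sub_cancel_of_le (initRank_mono _ hwc)
    have h1 := hL _ (pieceMap_mem_levelEnds hn hin hp (Or.inl hcC) hcD) _
      (ih c hcC hcw hcD hwc hoc.le)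
    rw [← pieceMap_mNext hn hin.le hp.1 hcD] at h1
    refine h1.mono (hφ ?_)
    have h2 : o (mNext n c) ≤ o c + 1 := initRank_le _ fun v hv hvn =>
      Order.lt_add_one_iff.2 (initRank_mono _ (by
        by_contra! hcv
        exact absurd (hv.2 c hcv) (not_le.2 hvn)))
    have h3 : b ≤ o c - o w₀ + 1 := by
      rw [← add_le_add_iff_left (o w₀), ← add_assoc, hoc]
      exact hb.trans h2
    rw [← Order.lt_add_one_iff, add_assoc _ _ (1 : Ordinal)]
    exact hξ'.trans_le (by gcongr)
  · have hlim : ∀ c, c < w → mNext n c < w := by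
      intro c hcw
      refine lt_of_le_of_ne (hwC.2 c hcw) fun heq => ?_
      rcases le_or_gt w₀ c with h | h
      · exact hsucc (exists_mNext_eq_of_gap hn hcw heq hw₀C h)
      · exact absurd (hw₀C.2 c h) (not_le.2 (heq ▸ hlt))
    obtain ⟨v, hvC, hwv, hvw, hv⟩ : ∃ v ∈ gapEnds n, w₀ ≤ v ∧ v < w ∧
        ξ' < ξ₀ + 1 + (o v - o w₀) := by
      rcases lt_or_ge ξ' (ξ₀ + 1) with h | h
      · exact ⟨w₀, hw₀C, le_rfl, hlt, h.trans_le le_self_add⟩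
      · have hγ : ξ₀ + 1 + (ξ' - (ξ₀ + 1)) = ξ' := Ordinal.add_sub_cancel_of_le h
        have hγb : ξ' - (ξ₀ + 1) < b := by
          rwa [← add_lt_add_iff_left (ξ₀ + 1), hγ]
        obtain ⟨v, hvC, hvw, hv⟩ := exists_le_initRank (isWF_gapEnds hn)
          (lt_of_lt_of_le (by gcongr : o w₀ + (ξ' - (ξ₀ + 1)) < o w₀ + b) hb)
        have hwv : w₀ ≤ v := by
          by_contra! h
          exact absurd (initRank_lt (isWF_gapEnds hn) hvC h) (not_lt.2 (le_self_add.trans hv))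
        have hwv' : w₀ ≤ mNext n v := hwv.trans (lt_mNext hn v).le
        refine ⟨mNext n v, mNext_mem_gapEnds hn v, hwv', hlim v hvw, ?_⟩
        rw [← hγ]
        gcongr
        rw [← add_lt_add_iff_left (o w₀),
          Ordinal.add_sub_cancel_of_le (initRank_mono (isWF_gapEnds hn) hwv')]
        exact hv.trans_lt (initRank_lt _ hvC (lt_mNext hn v))
    intro a ha
    obtain ⟨a', rfl⟩ := exists_pieceMap_eq (n := n) (i := i) (p := p) a
    have haw := pieceMap_strictMono.lt_iff_lt.1 ha
    set x := mNext n (max v a') with hx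
    have hvx : v ≤ x := (le_max_left _ _).trans (lt_mNext hn _).le
    have hax : a' < x := (le_max_right _ _).trans_lt (lt_mNext hn _)
    have hxw : x < w := hlim _ (max_lt hvw haw)
    have hwx : w₀ ≤ x := hwv.trans hvx
    have hxD := pieceDom_of_le hw hxw.le (hs0.le.trans hwx)
    have h1 := ih x (mNext_mem_gapEnds hn _) hxw hxD hwx
      (b := o x - o w₀) (Ordinal.add_sub_cancel_of_le (initRank_mono _ hwx)).le ξ' (hv.trans_le (by
        gcongr
        rw [← add_le_add_iff_left (o w₀),
          Ordinal.add_sub_cancel_of_le (initRank_mono (isWF_gapEnds hn) hwv),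
          Ordinal.add_sub_cancel_of_le (initRank_mono (isWF_gapEnds hn) hwx)]
        exact initRank_mono _ hvx))
    exact (h1 _ (pieceMap_strictMono hax)).trans
      (initRank_mono _ (pieceMap_strictMono.monotone hxw.le))

-- Tails of type ζ at one term of `pieceSeq` mean that many gaps below it, hence tails of type φ ζ
-- two terms later; iterating reaches everything below the next fixed point.
open Ordinal in
theorem exists_hasTails_of_lt_nfp (hn : 0 < n) (hi : i + 1 ≤ n) (hp : p ∈ levelEnds n i)
    {φ : Ordinal.{0} → Ordinal.{0}} (hφ : StrictMono φ)
    (hL : ∀ q ∈ levelEnds n (i + 1), ∀ ξ, (∀ ξ' < ξ, HasTails (isWF_gapEnds hn) q (φ ξ')) →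
      HasTails (isWF_gapEnds hn) (q + mIter n q (i + 1) / (i + 1 : ℕ)) (φ ξ))
    {ξ₀ : Ordinal.{0}} (h₀ : ∀ ξ' < ξ₀, HasTails (isWF_gapEnds hn) p (φ ξ')) {b : Ordinal.{0}}
    (hb : b < nfp φ ξ₀) : ∃ k, HasTails (isWF_gapEnds hn) (pieceSeq n i p k) b := by
  have hT := mIter_pos hn (Nat.le_of_succ_le hi) hp.1
  have hpC : p ∈ gapEnds n := levelEnds_subset_gapEnds hn (Nat.le_of_succ_le hi) hp
  have hw₀p : mNext n (p - mIter n p i) ≤ p := hpC.2 _ (by linarith)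
  have hmono := pieceSeq_strictMono hn hi hp
  have hstep : ∀ k, ∀ {b : Ordinal.{0}}, initRank (isWF_gapEnds hn) (mNext n (p - mIter n p i)) + b
      ≤ initRank (isWF_gapEnds hn) (pieceSeq n i p k) → ∀ ξ' < ξ₀ + 1 + b,
      HasTails (isWF_gapEnds hn) (pieceSeq n i p (k + 1)) (φ ξ') := fun k b hb => by
    rw [pieceSeq_succ]
    exact hasTails_pieceMap_of_initRank hn hi hp hφ.monotone hL h₀ (pieceSeq_mem hn hi hp k).2
      (pieceSeq_mem hn hi hp k).1 (hw₀p.trans (hmono.monotone (Nat.zero_le k))) hb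
  have key : ∀ N, ∃ k ≥ 1, HasTails (isWF_gapEnds hn) (pieceSeq n i p k) (φ^[N] (φ ξ₀)) := by
    intro N
    induction N with
    | zero =>
      exact ⟨1, le_rfl, hstep 0 (b := 0) (by rw [add_zero]; exact initRank_mono _ hw₀p) ξ₀
        (by rw [add_zero]; exact Order.lt_add_one_iff.2 le_rfl)⟩
    | succ N ih =>
      obtain ⟨k, hk, hkT⟩ := ih
      set ζ := φ^[N] (φ ξ₀) with hζ
      rw [Function.iterate_succ_apply', ← hζ]
      -- Two copies of ζ are taken because ξ₀ + 1 + ζ may equal ζ, while a strict inequality is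
      -- needed.
      refine ⟨k + 2, by omega, hstep (k + 1) (b := ζ + ζ) ?_ ζ ?_⟩
      · have h1 := hkT _ (hw₀p.trans_lt (hmono (show 0 < k by omega)))
        have h2 := hkT.pieceSeq_mono hn hi hp k.le_succ _ (hmono k.lt_succ_self)
        rw [← add_assoc]
        exact (add_le_add_left h1 ζ).trans h2
      · rcases eq_zero_or_pos ζ with h | h
        · rw [h, add_zero, add_zero]
          exact (zero_le (a := ξ₀)).trans_lt (Order.lt_add_one_iff.2 le_rfl)
        · exact (lt_add_of_pos_right ζ h).trans_le le_add_self
  obtain ⟨N, hN⟩ := lt_nfp_iff.1 hb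
  obtain ⟨k, -, hk⟩ := key N
  exact ⟨k, hk.mono (hN.le.trans (hφ.monotone.iterate N hφ.le_apply))⟩

-- Induction on j, that is, downward on the level i. Since φ_{j+1} enumerates the fixed points of
-- φ_j, passing to the next index is a next-fixed-point computation inside the piece; limits use
-- continuity.
open Ordinal in
theorem hasTails_veblen (hn : 0 < n) (j : ℕ) : ∀ i : ℕ, 0 < i → i + j + 1 = n → ∀ p ∈ levelEnds n i, ∀ ξ,
    (∀ ξ' < ξ, HasTails (isWF_gapEnds hn) p (veblen j ξ')) →
    HasTails (isWF_gapEnds hn) (p + mIter n p i / i) (veblen j ξ) := by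
  induction j with
  | zero =>
    intro i hi0 hin p hp ξ h
    simp only [Nat.cast_zero, veblen_zero_apply] at h ⊢
    exact hasTails_opow hn (by omega) hi0 hp h
  | succ j ih =>
    intro i hi0 hin p hp ξ h
    have hi : i < n := by omega
    have hL := ih (i + 1) i.succ_pos (by omega)
    have hfix : ∀ ξ, veblen (j : Ordinal.{0}) (veblen (j + 1 : ℕ) ξ) = veblen (j + 1 : ℕ) ξ :=
      veblen_veblen_of_lt (by exact_mod_cast j.lt_succ_self)
    have hderiv : veblen ((j + 1 : ℕ) : Ordinal.{0}) = deriv (veblen (j : Ordinal.{0})) := by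
      rw [Nat.cast_succ, veblen_add_one]
    have key : ∀ d < veblen (j + 1 : ℕ) ξ,
        ∃ k, HasTails (isWF_gapEnds hn) (pieceSeq n i p k) d := by
      intro d hd
      induction ξ using Ordinal.limitRecOn with
      | zero =>
        rw [hderiv, deriv_zero_right] at hd
        exact exists_hasTails_of_lt_nfp hn hi hp (veblen_right_strictMono _) hL
          (fun _ h => absurd h not_lt_zero) hd
      | add_one ξ _ =>
        rw [hderiv, deriv_add_one, ← hderiv] at hd
        refine exists_hasTails_of_lt_nfp hn hi hp (veblen_right_strictMono _) hL
          (fun ζ hζ => (h ξ (Order.lt_add_one_iff.2 le_rfl)).mono ?_) hd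
        rw [← hfix ξ]
        exact (veblen_right_strictMono _).monotone (Order.lt_add_one_iff.1 hζ)
      | limit ξ hξ _ =>
        obtain ⟨ξ', hξ', hd'⟩ := ((isNormal_veblen _).lt_iff_exists_lt hξ).1 hd
        exact ⟨0, (h ξ' hξ').mono hd'.le⟩
    intro a ha
    have hlt : ∀ l, initRank (isWF_gapEnds hn) (pieceSeq n i p l) <
        initRank (isWF_gapEnds hn) (p + mIter n p i / i) := fun l =>
      initRank_lt _ (pieceSeq_mem hn hi hp l).2 (pieceSeq_lt hn hi hi0 hp l)
    obtain ⟨k, hk⟩ := exists_lt_pieceSeq hi0 ha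
    refine add_le_of_forall_add_lt ((initRank_mono _ hk.le).trans (hlt k).le) fun d hd => ?_
    obtain ⟨l, hl⟩ := key d hd
    have hak : a < pieceSeq n i p (max k l) :=
      hk.trans_le ((pieceSeq_strictMono hn hi hp).monotone (le_max_left _ _))
    exact (hl.pieceSeq_mono hn hi hp (le_max_right k l) a hak).trans_lt (hlt _)

open Ordinal in
theorem exists_le_initRank_gapEnds (hn : 0 < n) (hn2 : 2 ≤ n) {b : Ordinal.{0}}
    (hb : b < veblen ((n - 1 : ℕ) : Ordinal.{0}) 0) :
    ∃ c ∈ gapEnds n, b ≤ initRank (isWF_gapEnds hn) c := by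
  obtain ⟨m, rfl⟩ := Nat.exists_eq_add_of_le' hn2
  -- At level 0 `pieceMap` is translation by 1 and the piece has no end, so the fixed-point
  -- iteration applies directly.
  have h0 : (0 : ℝ) ∈ levelEnds (m + 2) 0 :=
    ⟨le_rfl, fun u hu hu0 => absurd hu0 (not_lt.2 hu)⟩
  have hb' : b < nfp (veblen (m : Ordinal.{0})) 0 := by
    rw [← deriv_zero_right, ← veblen_add_one]
    exact_mod_cast hb
  obtain ⟨k, hk⟩ := exists_hasTails_of_lt_nfp hn (by omega) h0 (veblen_right_strictMono _)
    (hasTails_veblen hn m (0 + 1) (by omega) (by omega)) (fun _ h => absurd h not_lt_zero) hb'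
  exact ⟨_, (pieceSeq_mem hn (by omega) h0 k).2,
    le_add_self.trans (hk _ (sub_one_lt (pieceSeq (m + 2) 0 0 k)))⟩

theorem initRank_le_typein_mNext (hn : 0 < n) {S : Set ℝ} (hS : IsWellOrder S (· < ·))
    (hmem : ∀ c, mNext n c ∈ S) {c : ℝ} (hc : c ∈ gapEnds n) :
    initRank (isWF_gapEnds hn) c ≤ @Ordinal.typein S (· < ·) hS ⟨mNext n c, hmem c⟩ := by
  refine Set.WellFoundedOn.induction (isWF_gapEnds hn) hc (P := fun c =>
    initRank (isWF_gapEnds hn) c ≤ @Ordinal.typein S (· < ·) hS ⟨mNext n c, hmem c⟩)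
    fun c hc ih => initRank_le _ fun w hw hwc => (ih w hw hwc).trans_lt ?_
  exact (@Ordinal.typein_lt_typein S (· < ·) hS _ _).2
    (show mNext n w < mNext n c from (hc.2 w hwc).trans_lt (lt_mNext hn c))

theorem veblen_le_type (hn : 0 < n) (hn2 : 2 ≤ n) {S : Set ℝ} (hS : IsWellOrder S (· < ·))
    (hmem : ∀ c, mNext n c ∈ S) :
    Ordinal.veblen ((n - 1 : ℕ) : Ordinal.{0}) 0 ≤ @Ordinal.type S (· < ·) hS := by
  refine le_of_forall_lt fun b hb => ?_
  obtain ⟨c, hc, hbc⟩ := exists_le_initRank_gapEnds hn hn2 hb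
  exact (hbc.trans (initRank_le_typein_mNext hn hS hmem hc)).trans_lt
    (@Ordinal.typein_lt_type S (· < ·) hS _)

end

/-! ### The two bounds together -/

theorem type_le_veblen {n : ℕ} (hn2 : 2 ≤ n) {S : Set ℝ} (hS : S ⊆ fusible n)
    (hwo : IsWellOrder S (· < ·)) :
    @Ordinal.type S (· < ·) hwo ≤ Ordinal.veblen ((n - 1 : ℕ) : Ordinal.{0}) 0 := by
  obtain ⟨m, rfl⟩ := Nat.exists_eq_add_of_le' hn2
  have hC := (isFusionSet_fusible (n := m + 2) (by omega)).isClosedFusionSet_closure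
  exact type_le_of_initRank_lt hC.isWF (hS.trans subset_closure) hwo
    fun z _ => initRank_lt_veblen hC z

theorem theorem1 (n : ℕ) (hn : 2 ≤ n) :
    (∀ x : ℝ, ∃! y : ℝ, MRuns n x y) ∧
    fusible' n ⊆ fusible n ∧
    HasOrderType (fusible' n) (Ordinal.veblen ((n - 1 : ℕ) : Ordinal.{0}) 0) ∧
    HasOrderType (fusible n) (Ordinal.veblen ((n - 1 : ℕ) : Ordinal.{0}) 0) := by
  have hn0 : 0 < n := by omega
  have hsub : fusible' n ⊆ fusible n := by
    rintro _ ⟨x, y, h, rfl⟩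
    exact h.add_mem_fusible hn0
  have hwf := (isFusionSet_fusible hn0).isWF
  have hmem : ∀ c, mNext n c ∈ fusible' n := fun c => ⟨c, _, mRuns_mVal hn0 c, rfl⟩
  have main : ∀ S ⊆ fusible n, (∀ c, mNext n c ∈ S) →
      HasOrderType S (Ordinal.veblen ((n - 1 : ℕ) : Ordinal.{0}) 0) := fun S hS hSm =>
    ⟨(hwf.mono hS).isWellOrder, le_antisymm (type_le_veblen hn hS _) (veblen_le_type hn0 hn _ hSm)⟩
  refine ⟨fun x => ?_, hsub, main _ hsub hmem, main _ subset_rfl fun c => hsub (hmem c)⟩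
  obtain ⟨y, hy⟩ := exists_mRuns hn0 x
  exact ⟨y, hy, fun y' hy' => hy'.unique hy⟩
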